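/- Let $\mathfrak X$ be a complex manifold (Hausdorff, second countable, of finite dimension), let $r \ge 0$, let $\pi = (t_1,\ldots,t_r) \colon \mathfrak X \to \mathbb C^r$ be a holomorphic submersion (its differential is surjective at every point), and let $\mathfrak L \to \mathfrak X$ be a holomorphic line bundle with sheaf of holomorphic sections $\mathcal O_{\mathfrak L}$, $\mathcal O_{\mathfrak L}(U) = \Gamma_{\mathrm{hol}}(U,\mathfrak L)$. For an open set $U \subseteq \mathfrak X$ let $H^d(U,\mathcal O_{\mathfrak L})$ denote Čech cohomology, that is, the direct limit, over all open covers $\mathfrak U$ of $U$ ordered by refinement, of the cohomology $H^d(\mathfrak U,\mathcal O_{\mathfrak L})$ of the Čech complex of $\mathfrak U$. **Theorem (holomorphic Hadamard lemma).** Let $A \subseteq \{1,\ldots,r\}$, and let $U \subseteq \mathfrak X$ be an open subset such that $H^{d}(U,\mathcal O_{\mathfrak L}) = \{0\}$ for all $d \ge 1$. If a section $s \in \Gamma_{\mathrm{hol}}(U,\mathfrak L)$ vanishes at every point of $U \cap \bigcap_{i\in A}\{t_i = 0\}$ (an empty intersection being all of $\mathfrak X$), then there exist sections $s_i \in \Gamma_{\mathrm{hol}}(U,\mathfrak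 L)$, indexed by $i \in A$, such that $$ s = \sum_{i \in A} t_i s_i \quad\text{on } U. $$ -/

import Mathlib

open CategoryTheory TopologicalSpace Opposite Bundle
open scoped Manifold ContDiff

/-! ## Čech cohomology of a presheaf of modules, as a direct limit over open covers -/

namespace Cech

universe u w

section Presheaf

variable {k : Type*} [CommRing k] {X : Type u} [TopologicalSpace X]

/-- The restriction map `F(W) → F(V)` of a presheaf of modules. -/
def res (F : (Opens X)ᵒᵖ ⥤ ModuleCat.{w} k) {V W : Opens X} (h : V ≤ W) :
    F.obj (op W) →ₗ[k] F.obj (op V) :=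
  (F.map (homOfLE h).op).hom

theorem res_self (F : (Opens X)ᵒᵖ ⥤ ModuleCat.{w} k) {V : Opens X} (h : V ≤ V)
    (x : F.obj (op V)) : res F h x = x := by
  simp [res]

theorem res_res (F : (Opens X)ᵒᵖ ⥤ ModuleCat.{w} k) {V W Z : Opens X} (h : V ≤ W) (h' : W ≤ Z)
    (x : F.obj (op Z)) : res F h (res F h' x) = res F (h.trans h') x := by
  have : (homOfLE (h.trans h')).op = (homOfLE h').op ≫ (homOfLE h).op := Subsingleton.elim _ _
  simp [res, this]

/-- An open cover of the open set `U` : a family of open sets with union `U`. -/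
structure OpenCover (U : Opens X) where
  /-- the index set -/
  ι : Type u
  /-- the members of the cover -/
  obj : ι → Opens X
  /-- the members of the cover have union `U` -/
  iSup_obj : ⨆ i, obj i = U

namespace OpenCover

variable {U : Opens X}

/-- The intersection `U_{α₀} ∩ … ∩ U_{α_d}`. -/
def inter (𝔘 : OpenCover U) {d : ℕ} (α : Fin (d + 1) → 𝔘.ι) : Opens X :=
  ⨅ j, 𝔘.obj (α j)

theorem inter_comp_le (𝔘 : OpenCover U) {d e : ℕ} (α : Fin (d + 1) → 𝔘.ι)
    (f : Fin (e + 1) → Fin (d + 1)) : 𝔘.inter α ≤ 𝔘.inter (α ∘ f) :=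
  le_iInf fun j => iInf_le (fun i => 𝔘.obj (α i)) (f j)

/-- `𝔘 ≤ 𝔙` means that `𝔙` is a refinement of `𝔘`. -/
instance : Preorder (OpenCover U) where
  le 𝔘 𝔙 := ∀ j, ∃ i, 𝔙.obj j ≤ 𝔘.obj i
  le_refl _ j := ⟨j, le_rfl⟩
  le_trans _ _ _ h h' l :=
    let ⟨j, hj⟩ := h' l
    let ⟨i, hi⟩ := h j
    ⟨i, hj.trans hi⟩

theorem le_def {𝔘 𝔙 : OpenCover U} : 𝔘 ≤ 𝔙 ↔ ∀ j, ∃ i, 𝔙.obj j ≤ 𝔘.obj i := Iff.rfl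

instance : Nonempty (OpenCover U) := ⟨⟨PUnit, fun _ => U, iSup_const⟩⟩

/-- Any two covers have the common refinement by pairwise intersections. -/
instance : IsDirectedOrder (OpenCover U) where
  directed 𝔘 𝔙 :=
    ⟨⟨𝔘.ι × 𝔙.ι, fun p => 𝔘.obj p.1 ⊓ 𝔙.obj p.2, by
      rw [iSup_prod]
      simp only [← inf_iSup_eq, ← iSup_inf_eq, 𝔘.iSup_obj, 𝔙.iSup_obj, inf_idem]⟩,
      fun p => ⟨p.1, inf_le_left⟩, fun p => ⟨p.2, inf_le_right⟩⟩

end OpenCover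

variable {U : Opens X} (F : (Opens X)ᵒᵖ ⥤ ModuleCat.{w} k)

/-- Čech `d`-cochains: a section over `U_{α₀} ∩ … ∩ U_{α_d}` for every tuple of indices. -/
abbrev Cochain (𝔘 : OpenCover U) (d : ℕ) : Type _ :=
  ∀ α : Fin (d + 1) → 𝔘.ι, F.obj (op (𝔘.inter α))

/-- The Čech differential
`(δs)_{α₀…α_{d+1}} = ∑ₖ (-1)ᵏ s_{α₀…α̂ₖ…α_{d+1}}` (restricted to the intersection). -/
def δ (𝔘 : OpenCover U) (d : ℕ) : Cochain F 𝔘 d →ₗ[k] Cochain F 𝔘 (d + 1) :=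
  LinearMap.pi fun α => ∑ j : Fin (d + 2),
    (-1 : k) ^ (j : ℕ) • (res F (𝔘.inter_comp_le α j.succAbove) ∘ₗ LinearMap.proj (α ∘ j.succAbove))

/-- Čech `d`-cocycles. -/
def cocycles (𝔘 : OpenCover U) (d : ℕ) : Submodule k (Cochain F 𝔘 d) :=
  LinearMap.ker (δ F 𝔘 d)

/-- Čech `d`-coboundaries. -/
def coboundaries (𝔘 : OpenCover U) : ∀ d : ℕ, Submodule k (Cochain F 𝔘 d)
  | 0 => ⊥
  | d + 1 => LinearMap.range (δ F 𝔘 d)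

/-- The cohomology `H^d(𝔘; F)` of a cover. -/
abbrev CoverH (𝔘 : OpenCover U) (d : ℕ) : Type _ :=
  cocycles F 𝔘 d ⧸ (coboundaries F 𝔘 d).submoduleOf (cocycles F 𝔘 d)

section Refinement

variable {𝔘 𝔙 : OpenCover U}

theorem inter_le_of_refine (φ : 𝔙.ι → 𝔘.ι) (h : ∀ j, 𝔙.obj j ≤ 𝔘.obj (φ j)) {d : ℕ}
    (α : Fin (d + 1) → 𝔙.ι) : 𝔙.inter α ≤ 𝔘.inter (φ ∘ α) :=
  iInf_mono fun j => h (α j)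

/-- The map on cochains induced by a refinement map `φ`. -/
def pull (φ : 𝔙.ι → 𝔘.ι) (h : ∀ j, 𝔙.obj j ≤ 𝔘.obj (φ j)) (d : ℕ) :
    Cochain F 𝔘 d →ₗ[k] Cochain F 𝔙 d :=
  LinearMap.pi fun α => res F (inter_le_of_refine φ h α) ∘ₗ LinearMap.proj (φ ∘ α)

theorem δ_apply (d : ℕ) (s : Cochain F 𝔘 d) (α : Fin (d + 2) → 𝔘.ι) :
    δ F 𝔘 d s α = ∑ j : Fin (d + 2),
      (-1 : k) ^ (j : ℕ) • res F (𝔘.inter_comp_le α j.succAbove) (s (α ∘ j.succAbove)) := by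
  simp [δ]

theorem pull_apply (φ : 𝔙.ι → 𝔘.ι) (h : ∀ j, 𝔙.obj j ≤ 𝔘.obj (φ j)) (d : ℕ)
    (s : Cochain F 𝔘 d) (α : Fin (d + 1) → 𝔙.ι) :
    pull F φ h d s α = res F (inter_le_of_refine φ h α) (s (φ ∘ α)) := rfl

theorem pull_δ (φ : 𝔙.ι → 𝔘.ι) (h : ∀ j, 𝔙.obj j ≤ 𝔘.obj (φ j)) (d : ℕ)
    (s : Cochain F 𝔘 d) : pull F φ h (d + 1) (δ F 𝔘 d s) = δ F 𝔙 d (pull F φ h d s) := by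
  funext α
  simp only [pull_apply, δ_apply, map_sum, map_smul, res_res]
  rfl

theorem pull_mem_cocycles (φ : 𝔙.ι → 𝔘.ι) (h : ∀ j, 𝔙.obj j ≤ 𝔘.obj (φ j)) (d : ℕ)
    {s : Cochain F 𝔘 d} (hs : s ∈ cocycles F 𝔘 d) : pull F φ h d s ∈ cocycles F 𝔙 d := by
  rw [cocycles, LinearMap.mem_ker] at hs ⊢
  rw [← pull_δ, hs, map_zero]

theorem pull_mem_coboundaries (φ : 𝔙.ι → 𝔘.ι) (h : ∀ j, 𝔙.obj j ≤ 𝔘.obj (φ j)) (d : ℕ)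
    {s : Cochain F 𝔘 d} (hs : s ∈ coboundaries F 𝔘 d) :
    pull F φ h d s ∈ coboundaries F 𝔙 d := by
  cases d with
  | zero =>
    rw [coboundaries, Submodule.mem_bot] at hs ⊢
    rw [hs, map_zero]
  | succ d =>
    rw [coboundaries, LinearMap.mem_range] at hs ⊢
    obtain ⟨y, rfl⟩ := hs
    exact ⟨pull F φ h d y, (pull_δ F φ h d y).symm⟩

/-- The map `H^d(𝔘; F) → H^d(𝔙; F)` induced by a refinement map `φ`. -/
def pullH (φ : 𝔙.ι → 𝔘.ι) (h : ∀ j, 𝔙.obj j ≤ 𝔘.obj (φ j)) (d : ℕ) :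
    CoverH F 𝔘 d →ₗ[k] CoverH F 𝔙 d :=
  Submodule.mapQ _ _
    ((pull F φ h d).restrict fun _ hs => pull_mem_cocycles F φ h d hs)
    fun _ hs => pull_mem_coboundaries F φ h d hs

theorem res_congr {V : Opens X} {d : ℕ} (s : Cochain F 𝔘 d) {α β : Fin (d + 1) → 𝔘.ι}
    (e : α = β) (h : V ≤ 𝔘.inter α) (h' : V ≤ 𝔘.inter β) :
    res F h (s α) = res F h' (s β) := by
  subst e; rfl

/-! The map induced on cohomology by a refinement does not depend on the refinement map. -/

/-- The tuple `φ(α₀), …, φ(α_{i-1}), ψ(α_i), …, ψ(α_d)`. -/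
def mixed {I J : Type*} (φ ψ : J → I) {d : ℕ} (i : ℕ) (α : Fin (d + 1) → J) : Fin (d + 1) → I :=
  fun l => if (l : ℕ) < i then φ (α l) else ψ (α l)

/-- The tuple `φ(α₀), …, φ(α_i), ψ(α_i), …, ψ(α_d)`. -/
def prism {I J : Type*} (φ ψ : J → I) {d : ℕ} (i : ℕ) (α : Fin (d + 1) → J) : Fin (d + 2) → I :=
  fun l => if (l : ℕ) ≤ i then φ (α ⟨min l d, by omega⟩) else ψ (α ⟨l - 1, by omega⟩)

theorem le_mixed {φ ψ : 𝔙.ι → 𝔘.ι} (hφ : ∀ j, 𝔙.obj j ≤ 𝔘.obj (φ j))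
    (hψ : ∀ j, 𝔙.obj j ≤ 𝔘.obj (ψ j)) {d : ℕ} (i : ℕ) (α : Fin (d + 1) → 𝔙.ι) :
    𝔙.inter α ≤ 𝔘.inter (mixed φ ψ i α) := by
  refine le_iInf fun l => ?_
  unfold mixed
  split_ifs
  · exact (iInf_le _ l).trans (hφ _)
  · exact (iInf_le _ l).trans (hψ _)

theorem le_prism {φ ψ : 𝔙.ι → 𝔘.ι} (hφ : ∀ j, 𝔙.obj j ≤ 𝔘.obj (φ j))
    (hψ : ∀ j, 𝔙.obj j ≤ 𝔘.obj (ψ j)) {d : ℕ} (i : ℕ) (α : Fin (d + 1) → 𝔙.ι) :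
    𝔙.inter α ≤ 𝔘.inter (prism φ ψ i α) := by
  refine le_iInf fun l => ?_
  unfold prism
  split_ifs
  · exact (iInf_le (fun m => 𝔙.obj (α m)) _).trans (hφ _)
  · exact (iInf_le (fun m => 𝔙.obj (α m)) _).trans (hψ _)

theorem prism_sum {M : Type*} [AddCommGroup M] [Module k M] (n : ℕ)
    (a b : ℕ → ℕ → M) (g : ℕ → M)
    (h₁ : ∀ i j, j < i → i ≤ n → a i j = b j (i - 1))
    (h₂ : ∀ i, i ≤ n → a i i = g i)
    (h₃ : ∀ i, i ≤ n → a i (i + 1) = g (i + 1))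
    (h₄ : ∀ i j, i + 1 < j → j ≤ n + 1 → a i j = b (j - 1) i) :
    ∑ i ∈ Finset.range (n + 1), (-1 : k) ^ i • ∑ j ∈ Finset.range (n + 2), (-1 : k) ^ j • a i j
      = g 0 - g (n + 1) - ∑ j ∈ Finset.range (n + 1), (-1 : k) ^ j •
          ∑ i ∈ Finset.range n, (-1 : k) ^ i • b j i := by
  have sq : ∀ (i : ℕ) (x : M), (-1 : k) ^ i • (-1 : k) ^ i • x = x := fun i x => by
    rw [smul_smul, ← mul_pow]; simp
  have key : ∀ i ∈ Finset.range (n + 1),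
      (-1 : k) ^ i • ∑ j ∈ Finset.range (n + 2), (-1 : k) ^ j • a i j
      = (-1 : k) ^ i • ∑ j ∈ Finset.range i, (-1 : k) ^ j • b j (i - 1) - (g (i + 1) - g i)
        - (-1 : k) ^ i • ∑ x ∈ Finset.range (n - i), (-1 : k) ^ (i + 1 + x) • b (i + 1 + x) i := by
    intro i hi
    have hi : i ≤ n := Nat.lt_succ_iff.mp (Finset.mem_range.mp hi)
    have e : n + 2 = i + 2 + (n - i) := by omega
    rw [e, Finset.sum_range_add, Finset.sum_range_succ, Finset.sum_range_succ, h₂ i hi, h₃ i hi,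
      Finset.sum_congr rfl (fun j hj => by rw [h₁ i j (Finset.mem_range.mp hj) hi]),
      Finset.sum_congr (g := fun x => -((-1 : k) ^ (i + 1 + x) • b (i + 1 + x) i))
        (rfl : Finset.range (n - i) = _) (fun x hx => by
        have hx := Finset.mem_range.mp hx
        rw [h₄ i (i + 2 + x) (by omega) (by omega), show i + 2 + x - 1 = i + 1 + x by omega,
          show i + 2 + x = i + 1 + x + 1 by omega, pow_succ]
        simp), Finset.sum_neg_distrib]
    simp only [smul_add, smul_neg, sq, pow_succ, mul_neg, mul_one, neg_smul]
    abel
  rw [Finset.sum_congr rfl key, Finset.sum_sub_distrib, Finset.sum_sub_distrib,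
    Finset.sum_range_sub, Finset.sum_range_succ', Finset.sum_range_succ (n := n)]
  simp only [Finset.range_zero, Finset.sum_empty, smul_zero, add_zero, Nat.sub_self,
    Nat.add_sub_cancel]
  have swap : ∑ j ∈ Finset.range (n + 1), (-1 : k) ^ j •
      ∑ i ∈ Finset.range n, (-1 : k) ^ i • b j i
      = ∑ i ∈ Finset.range n, (-1 : k) ^ i •
        ∑ j ∈ Finset.range (n + 1), (-1 : k) ^ j • b j i := by
    simp only [Finset.smul_sum]
    rw [Finset.sum_comm]
    refine Finset.sum_congr rfl fun i _ => Finset.sum_congr rfl fun j _ => smul_comm _ _ _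
  have split : ∀ i ∈ Finset.range n, (-1 : k) ^ i •
        ∑ j ∈ Finset.range (n + 1), (-1 : k) ^ j • b j i
      = (-1 : k) ^ i • ∑ x ∈ Finset.range (n - i), (-1 : k) ^ (i + 1 + x) • b (i + 1 + x) i
        - (-1 : k) ^ (i + 1) • ∑ j ∈ Finset.range (i + 1), (-1 : k) ^ j • b j i := by
    intro i hi
    have hi := Finset.mem_range.mp hi
    have e : n + 1 = i + 1 + (n - i) := by omega
    rw [e, Finset.sum_range_add, pow_succ (-1 : k) i]
    simp only [smul_add, mul_neg, mul_one, neg_smul]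
    abel
  rw [swap, Finset.sum_congr rfl split, Finset.sum_sub_distrib]
  abel

theorem prism_face_diag {I J : Type*} (φ ψ : J → I) {d : ℕ} (i : ℕ) (hi : i < d + 2)
    (α : Fin (d + 1) → J) :
    prism φ ψ i α ∘ Fin.succAbove ⟨i, hi⟩ = mixed φ ψ i α := by
  funext l
  have hl := l.isLt
  simp only [Function.comp, prism, mixed, Fin.succAbove, Fin.lt_def, Fin.val_castSucc]
  by_cases h : (l : ℕ) < i
  · have e : (⟨min (l : ℕ) d, by omega⟩ : Fin (d + 1)) = l := Fin.ext (by simp; omega)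
    simp [h, h.le, e]
  · simp [h]

theorem prism_face_diag' {I J : Type*} (φ ψ : J → I) {d : ℕ} (i : ℕ) (hi : i + 1 < d + 2)
    (α : Fin (d + 1) → J) :
    prism φ ψ i α ∘ Fin.succAbove ⟨i + 1, hi⟩ = mixed φ ψ (i + 1) α := by
  funext l
  have hl := l.isLt
  simp only [Function.comp, prism, mixed, Fin.succAbove, Fin.lt_def, Fin.val_castSucc]
  by_cases h : (l : ℕ) < i + 1
  · have e : (⟨min (l : ℕ) d, by omega⟩ : Fin (d + 1)) = l := Fin.ext (by simp; omega)
    have h' : (l : ℕ) ≤ i := by omega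
    simp [h, h', e]
  · have h' : ¬ (l : ℕ) + 1 ≤ i := by omega
    simp [h, h']

theorem succAbove_mk {n : ℕ} (j : ℕ) (hj : j < n + 1) (l : Fin n) :
    Fin.succAbove ⟨j, hj⟩ l = ⟨if (l : ℕ) < j then l else l + 1, by split_ifs <;> omega⟩ := by
  ext
  simp only [Fin.succAbove, Fin.lt_def, Fin.val_castSucc]
  split_ifs <;> rfl

theorem prism_face_lt {I J : Type*} (φ ψ : J → I) {d : ℕ} (i j : ℕ) (hj : j < d + 2) (hji : j < i)
    (hj' : j < d + 3) (hi : i ≤ d + 1) (α : Fin (d + 2) → J) :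
    prism φ ψ i α ∘ Fin.succAbove ⟨j, hj'⟩ = prism φ ψ (i - 1) (α ∘ Fin.succAbove ⟨j, hj⟩) := by
  funext l
  have hl := l.isLt
  simp only [Function.comp, prism, succAbove_mk]
  have e : (if (l : ℕ) < j then (l : ℕ) else l + 1) ≤ i ↔ (l : ℕ) ≤ i - 1 := by
    split_ifs <;> omega
  simp only [e]
  by_cases h : (l : ℕ) ≤ i - 1
  · simp only [h, if_true]
    refine congrArg φ (congrArg α (Fin.ext ?_))
    simp only
    split_ifs <;> omega
  · simp only [h, if_false]
    refine congrArg ψ (congrArg α (Fin.ext ?_))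
    simp only
    split_ifs <;> omega

theorem prism_face_gt {I J : Type*} (φ ψ : J → I) {d : ℕ} (i j : ℕ) (hj : j - 1 < d + 2)
    (hji : i + 1 < j) (hj' : j < d + 3) (α : Fin (d + 2) → J) :
    prism φ ψ i α ∘ Fin.succAbove ⟨j, hj'⟩ = prism φ ψ i (α ∘ Fin.succAbove ⟨j - 1, hj⟩) := by
  funext l
  have hl := l.isLt
  simp only [Function.comp, prism, succAbove_mk]
  have e : (if (l : ℕ) < j then (l : ℕ) else l + 1) ≤ i ↔ (l : ℕ) ≤ i := by
    split_ifs <;> omega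
  simp only [e]
  by_cases h : (l : ℕ) ≤ i
  · simp only [h, if_true]
    refine congrArg φ (congrArg α (Fin.ext ?_))
    simp only
    split_ifs <;> omega
  · simp only [h, if_false]
    refine congrArg ψ (congrArg α (Fin.ext ?_))
    simp only
    split_ifs <;> omega

/-- Two refinement maps induce maps on cocycles that differ by coboundaries. -/
theorem pull_sub_pull_mem (φ ψ : 𝔙.ι → 𝔘.ι) (hφ : ∀ j, 𝔙.obj j ≤ 𝔘.obj (φ j))
    (hψ : ∀ j, 𝔙.obj j ≤ 𝔘.obj (ψ j)) (d : ℕ) {s : Cochain F 𝔘 d} (hs : s ∈ cocycles F 𝔘 d) :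
    pull F ψ hψ d s - pull F φ hφ d s ∈ coboundaries F 𝔙 d := by
  rw [cocycles, LinearMap.mem_ker] at hs
  let a (α : Fin (d + 1) → 𝔙.ι) (i j : ℕ) : F.obj (op (𝔙.inter α)) :=
    if hj : j < d + 2 then
      res F ((le_prism hφ hψ i α).trans (𝔘.inter_comp_le _ (Fin.succAbove ⟨j, hj⟩)))
        (s (prism φ ψ i α ∘ Fin.succAbove ⟨j, hj⟩))
    else 0
  let g (α : Fin (d + 1) → 𝔙.ι) (i : ℕ) : F.obj (op (𝔙.inter α)) :=
    res F (le_mixed hφ hψ i α) (s (mixed φ ψ i α))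
  have ha : ∀ α i, ∑ j ∈ Finset.range (d + 2), (-1 : k) ^ j • a α i j = 0 := by
    intro α i
    have h0 : res F (le_prism hφ hψ i α) (δ F 𝔘 d s (prism φ ψ i α)) = 0 := by
      rw [hs, Pi.zero_apply, map_zero]
    rw [δ_apply, map_sum] at h0
    rw [Finset.sum_range, ← h0]
    refine Finset.sum_congr rfl fun j _ => ?_
    rw [map_smul, res_res]
    simp [a]
  have hg0 : ∀ α, g α 0 = pull F ψ hψ d s α := fun α => by
    rw [pull_apply]
    exact res_congr F s (by funext l; simp [mixed]) _ _
  have hg1 : ∀ α, g α (d + 1) = pull F φ hφ d s α := fun α => by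
    rw [pull_apply]
    exact res_congr F s (by funext l; simp only [mixed, l.isLt, if_true]; rfl) _ _
  have h₂ : ∀ α i, i ≤ d → a α i i = g α i := fun α i hi => by
    have hj : i < d + 2 := by omega
    simp only [a, g, hj, dif_pos]
    exact res_congr F s (prism_face_diag φ ψ i hj α) _ _
  have h₃ : ∀ α i, i ≤ d → a α i (i + 1) = g α (i + 1) := fun α i hi => by
    have hj : i + 1 < d + 2 := by omega
    simp only [a, g, hj, dif_pos]
    exact res_congr F s (prism_face_diag' φ ψ i hj α) _ _
  cases d with
  | zero =>
    rw [coboundaries, Submodule.mem_bot]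
    funext α
    have := prism_sum (k := k) 0 (a α) (fun _ _ => 0) (g α) (by omega) (h₂ α) (h₃ α) (by omega)
    simp only [ha, smul_zero, Finset.sum_const_zero, sub_zero, hg0, hg1 α] at this
    exact this.symm
  | succ e =>
    rw [coboundaries, LinearMap.mem_range]
    refine ⟨fun β => ∑ i ∈ Finset.range (e + 1), (-1 : k) ^ i •
      res F (le_prism hφ hψ i β) (s (prism φ ψ i β)), ?_⟩
    funext α
    let b (j i : ℕ) : F.obj (op (𝔙.inter α)) :=
      if hj : j < e + 2 then
        res F ((𝔙.inter_comp_le α (Fin.succAbove ⟨j, hj⟩)).trans (le_prism hφ hψ i _))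
          (s (prism φ ψ i (α ∘ Fin.succAbove ⟨j, hj⟩)))
      else 0
    have := prism_sum (k := k) (e + 1) (a α) b (g α)
      (fun i j hji hi => by
        have hj : j < e + 2 := by omega
        have hj' : j < e + 1 + 2 := by omega
        simp only [a, b, hj, hj', dif_pos]
        exact res_congr F s (prism_face_lt φ ψ i j hj hji hj' hi α) _ _)
      (h₂ α) (h₃ α)
      (fun i j hij hj0 => by
        have hj : j - 1 < e + 2 := by omega
        have hj' : j < e + 1 + 2 := by omega
        simp only [a, b, hj, hj', dif_pos]
        exact res_congr F s (prism_face_gt φ ψ i j hj hij hj' α) _ _)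
    simp only [ha, smul_zero, Finset.sum_const_zero, hg0, hg1 α] at this
    rw [eq_comm, sub_eq_zero] at this
    rw [Pi.sub_apply, this, δ_apply, Finset.sum_range]
    refine Finset.sum_congr rfl fun j _ => ?_
    rw [map_sum]
    congr 1
    refine Finset.sum_congr rfl fun i _ => ?_
    rw [map_smul, res_res]
    simp [b]

theorem pullH_eq (φ ψ : 𝔙.ι → 𝔘.ι) (hφ : ∀ j, 𝔙.obj j ≤ 𝔘.obj (φ j))
    (hψ : ∀ j, 𝔙.obj j ≤ 𝔘.obj (ψ j)) (d : ℕ) : pullH F φ hφ d = pullH F ψ hψ d := by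
  refine LinearMap.ext fun x => ?_
  obtain ⟨s, rfl⟩ := Submodule.Quotient.mk_surjective _ x
  exact (Submodule.Quotient.eq _).mpr (pull_sub_pull_mem F ψ φ hψ hφ d s.2)

end Refinement

/-- The map `H^d(𝔘; F) → H^d(𝔙; F)` for a refinement `𝔙` of `𝔘`. -/
noncomputable def refineH (d : ℕ) (𝔘 𝔙 : OpenCover U) (h : 𝔘 ≤ 𝔙) :
    CoverH F 𝔘 d →ₗ[k] CoverH F 𝔙 d :=
  pullH F (fun j => (h j).choose) (fun j => (h j).choose_spec) d

theorem refineH_eq (d : ℕ) {𝔘 𝔙 : OpenCover U} (h : 𝔘 ≤ 𝔙) (φ : 𝔙.ι → 𝔘.ι)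
    (hφ : ∀ j, 𝔙.obj j ≤ 𝔘.obj (φ j)) : refineH F d 𝔘 𝔙 h = pullH F φ hφ d :=
  pullH_eq F _ _ _ _ d

instance (d : ℕ) :
    DirectedSystem (fun 𝔘 : OpenCover U => CoverH F 𝔘 d) (fun 𝔘 𝔙 h => refineH F d 𝔘 𝔙 h) where
  map_self 𝔘 x := by
    rw [refineH_eq F d _ id fun _ => le_rfl]
    obtain ⟨s, rfl⟩ := Submodule.Quotient.mk_surjective _ x
    refine congrArg Submodule.Quotient.mk (Subtype.ext (funext fun α => ?_))
    exact res_self F _ _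
  map_map {𝔚 𝔙 𝔘} h h' x := by
    rw [refineH_eq F d (h.trans h') ((fun j => (h j).choose) ∘ fun j => (h' j).choose)
      fun j => (h' j).choose_spec.trans (h _).choose_spec]
    obtain ⟨s, rfl⟩ := Submodule.Quotient.mk_surjective _ x
    refine congrArg Submodule.Quotient.mk (Subtype.ext (funext fun α => ?_))
    exact res_res F _ _ _

open Classical in
/-- The Čech cohomology `H^d(U; F)` : the direct limit of `H^d(𝔘; F)` over all open covers `𝔘`
of `U`, directed by refinement. -/
abbrev H (d : ℕ) (U : Opens X) : Type _ :=
  Module.DirectLimit (fun 𝔘 : OpenCover U => CoverH F 𝔘 d) (refineH F d)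

end Presheaf

end Cech

/-! ## Holomorphic sections of a holomorphic line bundle -/

section HolomorphicSections

universe u v

variable {E : Type*} [NormedAddCommGroup E] [NormedSpace ℂ E]
  {X : Type u} [TopologicalSpace X] [ChartedSpace E X]
  (L : X → Type v) [TopologicalSpace (TotalSpace ℂ L)]
  [∀ x, AddCommGroup (L x)] [∀ x, Module ℂ (L x)] [∀ x, TopologicalSpace (L x)]
  [FiberBundle ℂ L] [VectorBundle ℂ ℂ L]

variable (E) in
/-- A section `s` of `L` over the open set `U` is holomorphic if it is holomorphic as a map from
`U` to the total space of `L`. -/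
def IsHolSection (U : Opens X) (s : ∀ x : U, L x) : Prop :=
  ContMDiff 𝓘(ℂ, E) (𝓘(ℂ, E).prod 𝓘(ℂ, ℂ)) ω fun x : U => TotalSpace.mk' ℂ (x : X) (s x)

variable {L} in
set_option linter.unusedSectionVars false in
theorem isHolSection_iff {U : Opens X} {s : ∀ x : U, L x} :
    IsHolSection E L U s ↔ ∀ x₀ : U, ContMDiffAt 𝓘(ℂ, E) 𝓘(ℂ, ℂ) ω
      (fun x : U => (trivializationAt ℂ L (x₀ : X) ⟨x, s x⟩).2) x₀ := by
  refine forall_congr' fun x₀ => ?_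
  rw [contMDiffAt_totalSpace]
  exact and_iff_right contMDiff_subtype_val.contMDiffAt

variable (E) in
/-- `Γ_hol(U, L)` : the `ℂ`-vector space of holomorphic sections of `L` over `U`. -/
def holSections (U : Opens X) : Submodule ℂ (∀ x : U, L x) where
  carrier := {s | IsHolSection E L U s}
  zero_mem' := by
    rw [Set.mem_ofPred_eq, isHolSection_iff]
    intro x₀
    refine (contMDiffAt_const (c := (0 : ℂ))).congr_of_eventuallyEq ?_
    filter_upwards [(continuous_subtype_val.tendsto x₀).eventually
      ((trivializationAt ℂ L (x₀ : X)).open_baseSet.mem_nhds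
        (mem_baseSet_trivializationAt ℂ L (x₀ : X)))] with x hx
    exact ((trivializationAt ℂ L (x₀ : X)).linear ℂ hx).map_zero
  add_mem' {s t} hs ht := by
    rw [Set.mem_ofPred_eq, isHolSection_iff] at hs ht ⊢
    intro x₀
    refine ((hs x₀).add (ht x₀)).congr_of_eventuallyEq ?_
    filter_upwards [(continuous_subtype_val.tendsto x₀).eventually
      ((trivializationAt ℂ L (x₀ : X)).open_baseSet.mem_nhds
        (mem_baseSet_trivializationAt ℂ L (x₀ : X)))] with x hx
    exact ((trivializationAt ℂ L (x₀ : X)).linear ℂ hx).map_add _ _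
  smul_mem' c s hs := by
    rw [Set.mem_ofPred_eq, isHolSection_iff] at hs ⊢
    intro x₀
    refine ((contMDiffAt_const (I' := 𝓘(ℂ, ℂ)) (c := c)).smul (hs x₀)).congr_of_eventuallyEq ?_
    filter_upwards [(continuous_subtype_val.tendsto x₀).eventually
      ((trivializationAt ℂ L (x₀ : X)).open_baseSet.mem_nhds
        (mem_baseSet_trivializationAt ℂ L (x₀ : X)))] with x hx
    exact ((trivializationAt ℂ L (x₀ : X)).linear ℂ hx).map_smul _ _

variable (E) in
/-- Restriction of holomorphic sections to a smaller open set. -/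
def holRestrict {V U : Opens X} (h : V ≤ U) : holSections E L U →ₗ[ℂ] holSections E L V where
  toFun s := ⟨fun x => s.1 ⟨x, h x.2⟩, ContMDiff.comp s.2 (contMDiff_inclusion h)⟩
  map_add' _ _ := rfl
  map_smul' _ _ := rfl

variable (E) in
/-- The sheaf `𝒪_L` of holomorphic sections of `L`. -/
def holSheaf : (Opens X)ᵒᵖ ⥤ ModuleCat.{max u v} ℂ where
  obj U := ModuleCat.of ℂ (holSections E L U.unop)
  map f := ModuleCat.ofHom (holRestrict E L f.unop.le)
  map_id _ := rfl
  map_comp _ _ := rfl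

end HolomorphicSections

/-- A holomorphic submersion of complex manifolds: a holomorphic map whose differential is
surjective at every point. -/
def IsHolSubmersion {E : Type*} [NormedAddCommGroup E] [NormedSpace ℂ E]
    {E' : Type*} [NormedAddCommGroup E'] [NormedSpace ℂ E']
    {X : Type*} [TopologicalSpace X] [ChartedSpace E X]
    {Y : Type*} [TopologicalSpace Y] [ChartedSpace E' Y] (f : X → Y) : Prop :=
  ContMDiff 𝓘(ℂ, E) 𝓘(ℂ, E') ω f ∧
    ∀ x, Function.Surjective (mfderiv 𝓘(ℂ, E) 𝓘(ℂ, E') f x)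

/-! For `B ⊆ {1, …, r}` let `Z_B` be the common zero set of the `t i`, `i ∈ B`, and let `𝒪_B` be the
sheaf of sections of `L` along `Z_B` that locally extend to holomorphic sections. Since `t` is a
submersion, the `t i` are part of a local coordinate system, and for `i ∉ B` there is a short exact
sequence `0 → 𝒪_B → 𝒪_B → 𝒪_{B ∪ {i}} → 0` whose first map is multiplication by `t i` and whose
second is restriction. Injectivity says that `t i` is not a zero divisor on `Z_B`. Exactness in the
middle is local division by a coordinate, obtained from power series
(`AnalyticAt.exists_eq_mul_of_eq_zero`); the local quotients are unique on `Z_B` and hence glue.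

The sheaf for `B = ∅` is `𝒪_L`, acyclic on `U` by hypothesis. A quotient of acyclic sheaves by an
acyclic subsheaf is acyclic, and global sections lift along such a quotient. Induction on `B`
therefore shows that every `𝒪_B` is acyclic on `U` and that `Γ(U, 𝒪_L) → Γ(U, 𝒪_B)` is onto
(`locusSheaf_acyclic_and_surjective`).

Now let `s` vanish on `Z_{B ∪ {i}}`. Its restriction to `Z_B` is `t i` times a section of `𝒪_B`,
which lifts to a section `τ` of `L` over `U`. Then `s - t i • τ` vanishes on `Z_B`, and induction
finishes the proof (`exists_eq_sum_smul`).

Instead of a long exact sequence, cocycles are lifted by hand after refining the cover. This needs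
paracompactness of `U`, because the sequence is exact only locally
(`Cech.exists_refinement_of_local`). -/

namespace Cech

universe u w

/-! ### Čech cochains under refinement, and acyclicity -/

section Acyclic

variable {k : Type*} [CommRing k] {X : Type u} [TopologicalSpace X] {U : Opens X}

/-- The simplicial identity for faces that makes the terms of `δ ∘ δ` cancel in pairs. -/
theorem succAbove_comp_succAbove_of_le {d : ℕ} {i : Fin (d + 2)} {j : Fin (d + 3)}
    (h : (j : ℕ) ≤ i) (l : Fin (d + 1)) :
    j.succAbove (i.succAbove l) =
      i.succ.succAbove ((Fin.castLT j (lt_of_le_of_lt h i.isLt)).succAbove l) := by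
  ext
  simp only [Fin.succAbove, Fin.lt_def, Fin.val_castSucc, Fin.val_succ, Fin.val_castLT]
  split_ifs <;> simp_all <;> omega

theorem OpenCover.mem_inter (𝔘 : OpenCover U) {d : ℕ} (α : Fin (d + 1) → 𝔘.ι) (x : X) :
    x ∈ 𝔘.inter α ↔ ∀ l, x ∈ 𝔘.obj (α l) := by
  simp [OpenCover.inter, ← SetLike.mem_coe, Opens.coe_iInf]

/-- The Čech differential squares to zero. -/
theorem δ_δ (F : (Opens X)ᵒᵖ ⥤ ModuleCat.{w} k) (𝔘 : OpenCover U) (d : ℕ) (s : Cochain F 𝔘 d) :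
    δ F 𝔘 (d + 1) (δ F 𝔘 d s) = 0 := by
  funext α
  simp only [δ_apply, map_sum, map_smul, res_res, Finset.smul_sum, Pi.zero_apply, smul_smul]
  rw [Finset.sum_sigma']
  -- The terms with `p.1 ≤ p.2` cancel against all others under `(j, i) ↦ (i + 1, j)`: both delete
  -- the same two indices, and the signs are opposite.
  let S : Finset (Σ _ : Fin (d + 3), Fin (d + 2)) := {p | (p.1 : ℕ) ≤ p.2}
  rw [show (Finset.univ : Finset (Fin (d + 3))).sigma (fun _ => (Finset.univ : Finset (Fin (d + 2))))
      = Finset.univ from rfl, ← Finset.sum_add_sum_compl S, ← eq_neg_iff_add_eq_zero,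
    ← Finset.sum_neg_distrib]
  have hS : ∀ p, p ∈ S → (p.1 : ℕ) < d + 2 := fun p hp =>
    lt_of_le_of_lt (Finset.mem_filter.mp hp).2 p.2.isLt
  refine Finset.sum_bij (fun p hp => ⟨p.2.succ, p.1.castLT (hS p hp)⟩) ?_ ?_ ?_ ?_
  · intro p hp
    simp only [S, Finset.mem_filter_univ, Finset.compl_filter, Fin.val_succ, Fin.val_castLT] at hp ⊢
    omega
  · rintro ⟨i, j⟩ hp ⟨i', j'⟩ hp' h
    simp only [Sigma.mk.injEq, heq_eq_eq, Fin.ext_iff, Fin.val_castLT, Fin.val_succ] at h ⊢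
    omega
  · rintro ⟨i, j⟩ hp
    simp only [S, Finset.mem_filter_univ, Finset.compl_filter, not_le] at hp
    have hi : i ≠ 0 := by rintro rfl; simp at hp
    refine ⟨⟨j.castSucc, i.pred hi⟩, ?_, ?_⟩
    · simp only [S, Finset.mem_filter_univ, Fin.val_castSucc, Fin.val_pred]
      omega
    · simp
  · rintro ⟨i, j⟩ hp
    have hij : (i : ℕ) ≤ j := (Finset.mem_filter.mp hp).2
    rw [← neg_smul]
    congr 1
    · simp only [Fin.val_succ, Fin.val_castLT, pow_succ]
      ring
    · exact res_congr F s (funext fun l => congrArg α (succAbove_comp_succAbove_of_le hij l)) _ _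

/-- An open cover can be refined so that a property that holds locally on all
`(d + 1)`-fold intersections holds on the `(d + 1)`-fold intersections of the refinement. -/
theorem exists_refinement_of_local [ParacompactSpace U] [NormalSpace U] (𝔘 : OpenCover U) (d : ℕ)
    (R : (Fin (d + 1) → 𝔘.ι) → Opens X → Prop)
    (anti : ∀ α V W, W ≤ V → R α V → R α W) (bot : ∀ α, R α ⊥)
    (loc : ∀ α, ∀ x ∈ 𝔘.inter α, ∃ V : Opens X, x ∈ V ∧ R α V) :
    ∃ (𝔙 : OpenCover U) (φ : 𝔙.ι → 𝔘.ι), (∀ j, 𝔙.obj j ≤ 𝔘.obj (φ j)) ∧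
      ∀ β, R (φ ∘ β) (𝔙.inter β) := by
  have cov : ∀ x : U, ∃ i, (x : X) ∈ 𝔘.obj i := fun x => by
    have : (x : X) ∈ ⨆ i, 𝔘.obj i := by
      rw [𝔘.iSup_obj]
      exact x.2
    simpa using this
  obtain ⟨v, vo, vc, vf, vu⟩ := precise_refinement (fun i => (Subtype.val ⁻¹' (𝔘.obj i : Set X) : Set U))
    (fun i => (𝔘.obj i).isOpen.preimage continuous_subtype_val)
    (Set.iUnion_eq_univ_iff.2 fun x => cov x)
  obtain ⟨w, wc, wo, wv⟩ := exists_iUnion_eq_closure_subset vo vf.point_finite vc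
  choose τ hτ using Set.iUnion_eq_univ_iff.1 wc
  have wf : LocallyFinite fun i => closure (w i) := vf.subset wv
  -- The closures of the `w i` are locally finite, so only finitely many contain `x`. Hence only
  -- finitely many tuples `α` matter at `x`, and one neighbourhood `N` can serve them all; it can
  -- also avoid every `w i` whose closure misses `x`.
  have key : ∀ x : U, ∃ N : Set U, IsOpen N ∧ x ∈ N ∧ N ⊆ w (τ x) ∧
      (∀ i, (∃ y ∈ N, y ∈ w i) → x ∈ closure (w i)) ∧
      ∀ α : Fin (d + 1) → 𝔘.ι, (∀ l, x ∈ closure (w (α l))) →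
        ∃ V, R α V ∧ ∀ y ∈ N, (y : X) ∈ V := by
    intro x
    have fin : Finite {i // x ∈ closure (w i)} := wf.point_finite x
    have hx : ∀ α : Fin (d + 1) → {i // x ∈ closure (w i)}, ∃ V : Opens X, (x : X) ∈ V ∧
        R (fun l => α l) V := fun α => loc _ x <|
      (𝔘.mem_inter _ _).2 fun l => vu _ (wv _ (α l).2)
    choose V hxV hV using hx
    have h3 : (⋂ α, ((↑) ⁻¹' (V α : Set X) : Set U)) ∈ nhds x :=
      Filter.iInter_mem.2 fun α =>
        ((V α).isOpen.preimage continuous_subtype_val).mem_nhds (hxV α)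
    have h := Filter.inter_mem (Filter.inter_mem ((wo _).mem_nhds (hτ x))
      (wf.iInter_compl_mem_nhds (fun _ => isClosed_closure) x)) h3
    obtain ⟨N, hN, No, xN⟩ := mem_nhds_iff.1 h
    refine ⟨N, No, xN, fun y hy => (hN hy).1.1, ?_, ?_⟩
    · rintro i ⟨y, hy, hyi⟩
      by_contra hxi
      exact Set.mem_iInter₂.1 (hN hy).1.2 i hxi (subset_closure hyi)
    · intro α hα
      exact ⟨V fun l => ⟨α l, hα l⟩, hV fun l => ⟨α l, hα l⟩, fun y hy => Set.mem_iInter.1 (hN hy).2 _⟩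
  choose N No xN Nw Nc NR using key
  -- The refinement is indexed by the points of `U`, with `N x` as the member at `x`.
  let 𝔙 : OpenCover U := ⟨U, fun x => ⟨Subtype.val '' N x, U.isOpen.isOpenMap_subtype_val _ (No x)⟩,
    by
      refine le_antisymm (iSup_le fun x => ?_) fun x hx => ?_
      · rintro _ ⟨y, -, rfl⟩
        exact y.2
      · exact Opens.mem_iSup.2 ⟨⟨x, hx⟩, ⟨x, hx⟩, xN _, rfl⟩⟩
  refine ⟨𝔙, τ, ?_, ?_⟩
  · rintro x _ ⟨y, hy, rfl⟩
    exact vu _ (wv _ (subset_closure (Nw x hy)))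
  · intro β
    by_cases hb : 𝔙.inter β = ⊥
    · rw [hb]
      exact bot _
    · obtain ⟨z, hz⟩ : ∃ z, z ∈ 𝔙.inter β := by
        by_contra! hne
        exact hb (le_bot_iff.1 fun z hz => (hne z hz).elim)
      have hz' : ∀ l, ∃ y ∈ N (β l), (y : X) = z := (𝔙.mem_inter _ _).1 hz
      obtain ⟨y, hy, rfl⟩ := hz' 0
      have hy' : ∀ l, y ∈ N (β l) := fun l => by
        obtain ⟨y', h', e⟩ := hz' l
        rwa [Subtype.ext e] at h'
      -- The common point `y` lies in every `w (τ (β l))`, so `N (β 0)` meets each of them. By the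
      -- choice of `N`, the point `β 0` is then in all their closures, and the tuple `τ ∘ β` is
      -- among those `N (β 0)` was built for.
      obtain ⟨V, hV, hNV⟩ := NR (β 0) (τ ∘ β) fun l => Nc (β 0) _ ⟨y, hy, Nw _ (hy' l)⟩
      refine anti _ _ _ ((iInf_le _ 0).trans ?_) hV
      rintro _ ⟨y', h', rfl⟩
      exact hNV _ h'

/-- The map on cochains induced by a morphism of presheaves. -/
def mapCochain {F G : (Opens X)ᵒᵖ ⥤ ModuleCat.{w} k} (f : F ⟶ G) (𝔘 : OpenCover U) (d : ℕ) :
    Cochain F 𝔘 d →ₗ[k] Cochain G 𝔘 d :=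
  LinearMap.pi fun α => (f.app (op (𝔘.inter α))).hom ∘ₗ LinearMap.proj α

section Map

variable {F G : (Opens X)ᵒᵖ ⥤ ModuleCat.{w} k} (f : F ⟶ G)

theorem mapCochain_apply (𝔘 : OpenCover U) (d : ℕ) (s : Cochain F 𝔘 d)
    (α : Fin (d + 1) → 𝔘.ι) : mapCochain f 𝔘 d s α = (f.app _).hom (s α) := rfl

theorem app_res {V W : Opens X} (h : V ≤ W) (x : F.obj (op W)) :
    (f.app (op V)).hom (res F h x) = res G h ((f.app (op W)).hom x) := by
  have := congrArg (fun m => m.hom x) (f.naturality (homOfLE h).op)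
  simp_all [res]

theorem mapCochain_δ (𝔘 : OpenCover U) (d : ℕ) (s : Cochain F 𝔘 d) :
    mapCochain f 𝔘 (d + 1) (δ F 𝔘 d s) = δ G 𝔘 d (mapCochain f 𝔘 d s) := by
  funext α
  simp only [mapCochain_apply, δ_apply, map_sum, map_smul, app_res]

theorem mapCochain_pull {𝔘 𝔙 : OpenCover U} (φ : 𝔙.ι → 𝔘.ι) (h : ∀ j, 𝔙.obj j ≤ 𝔘.obj (φ j))
    (d : ℕ) (s : Cochain F 𝔘 d) :
    mapCochain f 𝔙 d (pull F φ h d s) = pull G φ h d (mapCochain f 𝔘 d s) := by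
  funext α
  simp only [mapCochain_apply, pull_apply, app_res]

end Map

theorem pull_pull (F : (Opens X)ᵒᵖ ⥤ ModuleCat.{w} k) {𝔘 𝔙 𝔚 : OpenCover U} (φ : 𝔙.ι → 𝔘.ι)
    (h : ∀ j, 𝔙.obj j ≤ 𝔘.obj (φ j)) (ψ : 𝔚.ι → 𝔙.ι) (h' : ∀ j, 𝔚.obj j ≤ 𝔙.obj (ψ j)) (d : ℕ)
    (s : Cochain F 𝔘 d) :
    pull F ψ h' d (pull F φ h d s) = pull F (φ ∘ ψ) (fun j => (h' j).trans (h (ψ j))) d s :=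
  funext fun _ => res_res F _ _ _

/-- Every Čech cocycle over `U` in degree `d + 1` becomes a coboundary after a refinement. -/
def AcyclicOver (F : (Opens X)ᵒᵖ ⥤ ModuleCat.{w} k) (U : Opens X) : Prop :=
  ∀ (d : ℕ) (𝔘 : OpenCover U) (s : Cochain F 𝔘 (d + 1)), δ F 𝔘 (d + 1) s = 0 →
    ∃ (𝔙 : OpenCover U) (φ : 𝔙.ι → 𝔘.ι) (h : ∀ j, 𝔙.obj j ≤ 𝔘.obj (φ j)) (y : Cochain F 𝔙 d),
      δ F 𝔙 d y = pull F φ h (d + 1) s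

/-- An element that vanishes in a direct limit already vanishes at some later stage, and the map to
that stage may be computed with any refinement map. -/
theorem acyclicOver_of_subsingleton_H (F : (Opens X)ᵒᵖ ⥤ ModuleCat.{w} k)
    (hF : ∀ d : ℕ, 1 ≤ d → Subsingleton (H F d U)) : AcyclicOver F U := by
  classical
  intro d 𝔘 s hs
  have := hF (d + 1) (by omega)
  obtain ⟨𝔙, h, e⟩ := Module.DirectLimit.of.zero_exact
    (R := k) (G := fun 𝔘 : OpenCover U => CoverH F 𝔘 (d + 1)) (f := refineH F (d + 1))
    (i := 𝔘) (x := Submodule.Quotient.mk (⟨s, hs⟩ : cocycles F 𝔘 (d + 1)))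
    (Subsingleton.elim (α := H F (d + 1) U) _ _)
  obtain ⟨φ, hφ⟩ : ∃ φ : 𝔙.ι → 𝔘.ι, ∀ j, 𝔙.obj j ≤ 𝔘.obj (φ j) :=
    ⟨fun j => (h j).choose, fun j => (h j).choose_spec⟩
  rw [refineH_eq F _ h φ hφ] at e
  have e' := (Submodule.Quotient.mk_eq_zero _).1 e
  obtain ⟨y, hy⟩ : _ ∈ LinearMap.range (δ F 𝔙 d) := e'
  exact ⟨𝔙, φ, hφ, y, hy⟩

/-- A morphism of presheaves bijective on all sections transports acyclicity. -/
theorem AcyclicOver.of_bijective {F G : (Opens X)ᵒᵖ ⥤ ModuleCat.{w} k} (f : F ⟶ G)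
    (hf : ∀ V, Function.Bijective (f.app (op V)).hom) (hF : AcyclicOver F U) :
    AcyclicOver G U := by
  intro d 𝔘 s hs
  choose t ht using fun α => (hf (𝔘.inter α)).2 (s α)
  have hts : mapCochain f 𝔘 (d + 1) t = s := funext ht
  obtain ⟨𝔙, φ, h, y, hy⟩ := hF d 𝔘 t <| by
    funext α
    apply (hf _).1
    rw [← mapCochain_apply, mapCochain_δ, hts, hs, Pi.zero_apply, Pi.zero_apply, map_zero]
  refine ⟨𝔙, φ, h, mapCochain f 𝔙 d y, ?_⟩
  rw [← mapCochain_δ, hy, mapCochain_pull, hts]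

/-! ### Short exact sequences: lifting cocycles and global sections -/

section Exact

variable {F G K : (Opens X)ᵒᵖ ⥤ ModuleCat.{w} k} (f : F ⟶ G) (g : G ⟶ K)

/-- For a locally surjective morphism, cochains lift after a refinement. -/
theorem exists_lift_cochain [ParacompactSpace U] [NormalSpace U]
    (hbot : ∀ x : K.obj (op ⊥), x = 0)
    (surj : ∀ (V : Opens X) (s : K.obj (op V)), ∀ x ∈ V, ∃ (W : Opens X) (h : W ≤ V), x ∈ W ∧
      ∃ y, (g.app (op W)).hom y = res K h s)
    (𝔘 : OpenCover U) (d : ℕ) (s : Cochain K 𝔘 d) :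
    ∃ (𝔙 : OpenCover U) (φ : 𝔙.ι → 𝔘.ι) (h : ∀ j, 𝔙.obj j ≤ 𝔘.obj (φ j)) (y : Cochain G 𝔙 d),
      mapCochain g 𝔙 d y = pull K φ h d s := by
  obtain ⟨𝔙, φ, h, H⟩ := exists_refinement_of_local 𝔘 d
    (fun α V => ∃ (h : V ≤ 𝔘.inter α) (y : _), (g.app (op V)).hom y = res K h (s α))
    (by
      rintro α V W hWV ⟨h, y, hy⟩
      exact ⟨hWV.trans h, res G hWV y, by rw [app_res, hy, res_res]⟩)
    (fun α => ⟨bot_le, 0, by rw [map_zero, hbot (res K _ _)]⟩)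
    (fun α x hx => by
      obtain ⟨W, h, hxW, y, hy⟩ := surj _ (s α) x hx
      exact ⟨W, hxW, h, y, hy⟩)
  choose hle y hy using H
  exact ⟨𝔙, φ, h, y, funext hy⟩

/-- For a short exact sequence `0 → F → G → K → 0` with `F` acyclic, cocycles of `K` lift to
cocycles of `G` after a refinement. -/
theorem exists_lift_cocycle [ParacompactSpace U] [NormalSpace U]
    (hbot : ∀ x : K.obj (op ⊥), x = 0)
    (inj : ∀ V, Function.Injective (f.app (op V)).hom)
    (exact : ∀ (V : Opens X) (s : G.obj (op V)), (g.app (op V)).hom s = 0 ↔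
      ∃ y, (f.app (op V)).hom y = s)
    (surj : ∀ (V : Opens X) (s : K.obj (op V)), ∀ x ∈ V, ∃ (W : Opens X) (h : W ≤ V), x ∈ W ∧
      ∃ y, (g.app (op W)).hom y = res K h s)
    (hF : AcyclicOver F U) (𝔘 : OpenCover U) (d : ℕ) (s : Cochain K 𝔘 d) (hs : δ K 𝔘 d s = 0) :
    ∃ (𝔙 : OpenCover U) (φ : 𝔙.ι → 𝔘.ι) (h : ∀ j, 𝔙.obj j ≤ 𝔘.obj (φ j)) (y : Cochain G 𝔙 d),
      mapCochain g 𝔙 d y = pull K φ h d s ∧ δ G 𝔙 d y = 0 := by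
  obtain ⟨𝔙, φ, h, b, hb⟩ := exists_lift_cochain g hbot surj 𝔘 d s
  have h0 : mapCochain g 𝔙 (d + 1) (δ G 𝔙 d b) = 0 := by
    rw [mapCochain_δ, hb, ← pull_δ, hs, map_zero]
  -- The cocycle `a` represents the image of `s` under the connecting homomorphism. Acyclicity of
  -- `F` makes it `δ c` after refinement, and subtracting the image of `c` corrects the lift `b` to
  -- a cocycle.
  choose a ha using fun α => (exact _ _).1 (congrFun h0 α)
  have ha' : mapCochain f 𝔙 (d + 1) a = δ G 𝔙 d b := funext ha
  obtain ⟨𝔚, ψ, h', c, hc⟩ := hF d 𝔙 a <| by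
    funext α
    apply inj
    rw [← mapCochain_apply, mapCochain_δ, ha', δ_δ, Pi.zero_apply, Pi.zero_apply, map_zero]
  have hgf : mapCochain g 𝔚 d (mapCochain f 𝔚 d c) = 0 :=
    funext fun α => (exact _ _).2 ⟨_, rfl⟩
  refine ⟨𝔚, φ ∘ ψ, fun j => (h' j).trans (h (ψ j)),
    pull G ψ h' d b - mapCochain f 𝔚 d c, ?_, ?_⟩
  · rw [map_sub, hgf, sub_zero, mapCochain_pull, hb, pull_pull]
  · rw [map_sub, ← pull_δ, ← mapCochain_δ, hc, mapCochain_pull, ha', sub_self]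

/-- In a short exact sequence the quotient of acyclic sheaves is acyclic. -/
theorem AcyclicOver.of_exact [ParacompactSpace U] [NormalSpace U]
    (hbot : ∀ x : K.obj (op ⊥), x = 0)
    (inj : ∀ V, Function.Injective (f.app (op V)).hom)
    (exact : ∀ (V : Opens X) (s : G.obj (op V)), (g.app (op V)).hom s = 0 ↔
      ∃ y, (f.app (op V)).hom y = s)
    (surj : ∀ (V : Opens X) (s : K.obj (op V)), ∀ x ∈ V, ∃ (W : Opens X) (h : W ≤ V), x ∈ W ∧
      ∃ y, (g.app (op W)).hom y = res K h s)
    (hF : AcyclicOver F U) (hG : AcyclicOver G U) : AcyclicOver K U := by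
  intro d 𝔘 s hs
  obtain ⟨𝔙, φ, h, b, hb, hb0⟩ := exists_lift_cocycle f g hbot inj exact surj hF 𝔘 (d + 1) s hs
  obtain ⟨𝔚, ψ, h', c, hc⟩ := hG d 𝔙 b hb0
  refine ⟨𝔚, φ ∘ ψ, fun j => (h' j).trans (h (ψ j)), mapCochain g 𝔚 d c, ?_⟩
  rw [← mapCochain_δ, hc, mapCochain_pull, hb, pull_pull]

/-- In a short exact sequence of sheaves with acyclic kernel, global sections of the quotient
lift. -/
theorem surjective_of_exact [ParacompactSpace U] [NormalSpace U]
    (hbot : ∀ x : K.obj (op ⊥), x = 0)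
    (inj : ∀ V, Function.Injective (f.app (op V)).hom)
    (exact : ∀ (V : Opens X) (s : G.obj (op V)), (g.app (op V)).hom s = 0 ↔
      ∃ y, (f.app (op V)).hom y = s)
    (surj : ∀ (V : Opens X) (s : K.obj (op V)), ∀ x ∈ V, ∃ (W : Opens X) (h : W ≤ V), x ∈ W ∧
      ∃ y, (g.app (op W)).hom y = res K h s)
    (glue : ∀ (𝔘 : OpenCover U) (b : Cochain G 𝔘 0), δ G 𝔘 0 b = 0 →
      ∃ y : G.obj (op U), ∀ (α : Fin 1 → 𝔘.ι) (h : 𝔘.inter α ≤ U), res G h y = b α)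
    (sep : ∀ (𝔘 : OpenCover U) (x y : K.obj (op U)),
      (∀ (α : Fin 1 → 𝔘.ι) (h : 𝔘.inter α ≤ U), res K h x = res K h y) → x = y)
    (hF : AcyclicOver F U) : Function.Surjective (g.app (op U)).hom := by
  intro s
  -- A global section is a `0`-cocycle on the one-member cover; a cocycle lifting it glues to the
  -- desired global section of `G`.
  let 𝔘 : OpenCover U := ⟨PUnit, fun _ => U, iSup_const⟩
  have hle : ∀ {𝔙 : OpenCover U} {d : ℕ} (α : Fin (d + 1) → 𝔙.ι), 𝔙.inter α ≤ U := fun {𝔙} _ α =>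
    (iInf_le _ 0).trans ((le_iSup 𝔙.obj _).trans_eq 𝔙.iSup_obj)
  obtain ⟨𝔙, φ, h, b, hb, hb0⟩ := exists_lift_cocycle f g hbot inj exact surj hF 𝔘 0
    (fun α => res K (hle α) s) (by
      funext α
      simp [δ_apply, res_res, Fin.sum_univ_two])
  obtain ⟨y, hy⟩ := glue 𝔙 b hb0
  refine ⟨y, sep 𝔙 _ _ fun α h' => ?_⟩
  rw [← app_res, hy α h']
  have := congrFun hb α
  rw [mapCochain_apply, pull_apply, res_res] at this
  exact this

end Exact

end Acyclic

end Cech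

/-! ### Dividing an analytic function by a linear form -/

section Division

variable {V : Type*} [NormedAddCommGroup V] [NormedSpace ℂ V]

/-- The sum over `j` of the maps `(v₀, …, v_{n-1}) ↦ m(Q v₀, …, Q v_{j-1}, e, v_j, …, v_{n-1})`. -/
noncomputable def ContinuousMultilinearMap.telescope {n : ℕ}
    (m : ContinuousMultilinearMap ℂ (fun _ : Fin (n + 1) => V) ℂ) (Q : V →L[ℂ] V) (e : V) :
    ContinuousMultilinearMap ℂ (fun _ : Fin n => V) ℂ :=
  ∑ j : Fin (n + 1), (m.curryMid j e).compContinuousLinearMap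
    fun i => if (i : ℕ) < j then Q else ContinuousLinearMap.id ℂ V

/-- Replace `z` by `Q z` one slot at a time, from the left. Each replacement changes the value by
`m` with `z - Q z = ℓ z • e` in that slot, and the changes sum to the total difference. -/
theorem ContinuousMultilinearMap.mul_telescope_apply {n : ℕ}
    (m : ContinuousMultilinearMap ℂ (fun _ : Fin (n + 1) => V) ℂ) (Q : V →L[ℂ] V) (e : V)
    (ℓ : V →L[ℂ] ℂ) (hQ : ∀ z, z - Q z = ℓ z • e) (z : V) :
    ℓ z * m.telescope Q e (fun _ => z) = m (fun _ => z) - m fun _ => Q z := by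
  let T : ℕ → ℂ := fun j => m fun i => if (i : ℕ) < j then Q z else z
  have step : ∀ j : Fin (n + 1), ℓ z * (m.curryMid j e).compContinuousLinearMap
      (fun i => if (i : ℕ) < j then Q else ContinuousLinearMap.id ℂ V) (fun _ => z)
      = T j - T (j + 1) := by
    intro j
    have h1 : (fun i : Fin (n + 1) => if (i : ℕ) < j then Q z else z)
        = Function.update (fun i : Fin (n + 1) => if (i : ℕ) < j then Q z else z) j z := by
      rw [eq_comm, Function.update_eq_self_iff]
      simp
    have h2 : (fun i : Fin (n + 1) => if (i : ℕ) < j + 1 then Q z else z)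
        = Function.update (fun i : Fin (n + 1) => if (i : ℕ) < j then Q z else z) j (Q z) := by
      funext i
      by_cases h : i = j
      · subst h; simp
      · have : (i : ℕ) ≠ j := fun h' => h (Fin.ext h')
        rw [Function.update_of_ne h]
        congr 1
        simp only [eq_iff_iff]
        omega
    simp only [T]
    rw [h1, h2, ← m.map_update_sub, hQ, m.map_update_smul, smul_eq_mul]
    congr 1
    change m _ = m _
    congr 1
    funext i
    rcases Fin.eq_self_or_eq_succAbove j i with rfl | ⟨l, rfl⟩
    · simp
    · rw [Fin.insertNth_apply_succAbove, Function.update_of_ne (Fin.succAbove_ne j l)]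
      have : ((l : ℕ) < j) ↔ ((j.succAbove l : ℕ) < j) := by
        simp only [Fin.succAbove, Fin.lt_def, Fin.val_castSucc]
        split_ifs <;> simp <;> omega
      by_cases h : (l : ℕ) < j
      · simp [h, this.1 h]
      · simp [h, mt this.2 h]
  rw [ContinuousMultilinearMap.telescope, _root_.sum_apply, Finset.mul_sum,
    Finset.sum_congr rfl fun j _ => step j, Fin.sum_univ_eq_sum_range (fun j => T j - T (j + 1)),
    Finset.sum_range_sub']
  simp only [T, not_lt_zero, if_false]
  congr 2
  funext i
  simp [i.isLt]

/-- There are `n + 1` summands, each with `n` slots precomposed with `Q` or the identity; `1 ≤ M`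
lets `M` bound both. -/
theorem ContinuousMultilinearMap.norm_telescope_le {n : ℕ}
    (m : ContinuousMultilinearMap ℂ (fun _ : Fin (n + 1) => V) ℂ) (Q : V →L[ℂ] V) (e : V)
    {M : ℝ} (hM : 1 ≤ M) (hQM : ‖Q‖ ≤ M) :
    ‖m.telescope Q e‖ ≤ (n + 1) * (‖m‖ * ‖e‖ * M ^ n) := by
  refine (norm_sum_le _ _).trans ?_
  have : ∀ j ∈ (Finset.univ : Finset (Fin (n + 1))), ‖(m.curryMid j e).compContinuousLinearMap
      (fun i => if (i : ℕ) < j then Q else ContinuousLinearMap.id ℂ V)‖ ≤ ‖m‖ * ‖e‖ * M ^ n := by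
    intro j _
    refine (ContinuousMultilinearMap.norm_compContinuousLinearMap_le _ _).trans ?_
    gcongr
    · exact ((m.curryMid j).le_opNorm e).trans_eq (by rw [m.norm_curryMid])
    · refine (Finset.prod_le_prod (g := fun _ => M) (fun i _ => norm_nonneg _)
        fun i _ => ?_).trans_eq (by simp)
      split_ifs
      · exact hQM
      · exact ContinuousLinearMap.norm_id_le.trans hM
  refine (Finset.sum_le_sum this).trans_eq ?_
  simp

/-- With `Q` the projection onto `ker ℓ` along `e`, the vanishing of `f` on `ker ℓ` gives `f v = f v
- f (Q v)` near `0`. Each homogeneous term of this difference is divisible by `ℓ v`, and the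
quotients form a convergent power series. -/
theorem AnalyticAt.exists_eq_mul_of_eq_zero_aux {f : V → ℂ} (hf : AnalyticAt ℂ f 0)
    (ℓ : V →L[ℂ] ℂ) {e : V} (he : ℓ e = 1) (h0 : ∀ᶠ v in nhds 0, ℓ v = 0 → f v = 0) :
    ∃ g : V → ℂ, AnalyticAt ℂ g 0 ∧ ∀ᶠ v in nhds 0, f v = ℓ v * g v := by
  obtain ⟨p, R, hp⟩ := hf
  let Q : V →L[ℂ] V := ContinuousLinearMap.id ℂ V - ℓ.smulRight e
  have hQ : ∀ z, z - Q z = ℓ z • e := fun z => by simp [Q]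
  have hℓQ : ∀ z, ℓ (Q z) = 0 := fun z => by simp [Q, he]
  let q : FormalMultilinearSeries ℂ V ℂ := fun n => (p (n + 1)).telescope Q e
  obtain ⟨s, hs0, hsp⟩ := ENNReal.lt_iff_exists_nnreal_btwn.1 (hp.r_pos.trans_le hp.r_le)
  obtain ⟨C, hC, hpC⟩ := p.norm_mul_pow_le_of_lt_radius hsp
  have hs : (0 : ℝ) < s := by exact_mod_cast hs0
  let M : ℝ := max 1 ‖Q‖
  have hM1 : 1 ≤ M := le_max_left _ _
  have hM0 : 0 < M := by positivity
  have hq : 0 < q.radius := by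
    -- In the norm bound, the factor `M ^ n` is absorbed by dividing the radius by `M`, and `n + 1 ≤
    -- 2 ^ n` by the further factor `2`.
    let ρ : NNReal := ⟨s / (2 * M), by positivity⟩
    have hρ : 0 < ρ := by change (0 : ℝ) < s / (2 * M); positivity
    refine lt_of_lt_of_le (ENNReal.coe_pos.2 hρ) (q.le_radius_of_bound (‖e‖ * C / s) fun n => ?_)
    have h1 := (p (n + 1)).norm_telescope_le Q e hM1 (le_max_right _ _)
    have h2 : ((n : ℝ) + 1) / 2 ^ n ≤ 1 := by
      rw [div_le_one (by positivity)]
      exact_mod_cast Nat.lt_two_pow_self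
    calc ‖q n‖ * (ρ : ℝ) ^ n
        ≤ (n + 1) * (‖p (n + 1)‖ * ‖e‖ * M ^ n) * (s / (2 * M)) ^ n := by
          refine mul_le_mul h1 le_rfl (pow_nonneg ρ.2 n) ?_
          positivity
      _ = ((n + 1) / 2 ^ n) * (‖e‖ * (‖p (n + 1)‖ * s ^ (n + 1)) / s) := by
          rw [div_pow, mul_pow]
          field_simp
          ring
      _ ≤ 1 * (‖e‖ * C / s) := by
          gcongr
          exact hpC _
      _ = ‖e‖ * C / s := one_mul _
  have hqs := q.hasFPowerSeriesOnBall hq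
  refine ⟨q.sum, hqs.analyticAt, ?_⟩
  have t1 : ∀ᶠ v in nhds (0 : V), v ∈ Metric.eball (0 : V) R := Metric.eball_mem_nhds _ hp.r_pos
  have t2 : ∀ᶠ v in nhds (0 : V), v ∈ Metric.eball (0 : V) q.radius :=
    Metric.eball_mem_nhds _ hq
  have tQ : Filter.Tendsto Q (nhds 0) (nhds 0) := by
    simpa using Q.continuous.tendsto 0
  filter_upwards [t1, tQ.eventually t1, t2, tQ.eventually h0] with v h1 h1' h2 h3
  have a1 := hp.hasSum h1
  have a2 := hp.hasSum h1'
  have a3 := (hqs.hasSum h2).mul_left (ℓ v)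
  simp only [zero_add] at a1 a2 a3
  rw [h3 (hℓQ v)] at a2
  have a4 := a1.sub a2
  -- The constant terms of the two series cancel, so the sum starts at `n = 1`, which matches the
  -- index shift in `q`.
  rw [sub_zero, ← hasSum_nat_add_iff' 1, Finset.sum_range_one,
    Subsingleton.elim (fun _ : Fin 0 => Q v) fun _ => v, sub_self, sub_zero] at a4
  refine a4.unique ?_
  have e1 : (fun n => ℓ v * q n fun _ => v)
      = fun n => p (n + 1) (fun _ => v) - p (n + 1) fun _ => Q v :=
    funext fun n => (p (n + 1)).mul_telescope_apply Q e ℓ hQ v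
  rwa [e1] at a3

/-- An analytic function vanishing on the hyperplane `ℓ = 0` is locally divisible by `ℓ`. -/
theorem AnalyticAt.exists_eq_mul_of_eq_zero {f : V → ℂ} {v₀ : V} (hf : AnalyticAt ℂ f v₀)
    (ℓ : V →L[ℂ] ℂ) {e : V} (he : ℓ e = 1) (hv₀ : ℓ v₀ = 0)
    (h0 : ∀ᶠ v in nhds v₀, ℓ v = 0 → f v = 0) :
    ∃ g : V → ℂ, AnalyticAt ℂ g v₀ ∧ ∀ᶠ v in nhds v₀, f v = ℓ v * g v := by
  have t : Filter.Tendsto (fun v => v₀ + v) (nhds 0) (nhds v₀) := by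
    simpa using ((continuous_const_add v₀).tendsto 0)
  have t' : Filter.Tendsto (fun v => v - v₀) (nhds v₀) (nhds 0) := by
    simpa using ((continuous_sub_right v₀).tendsto v₀)
  have hf' : AnalyticAt ℂ (fun v => f (v₀ + v)) 0 :=
    AnalyticAt.fun_comp (by simpa using hf) (analyticAt_const.add analyticAt_id)
  obtain ⟨g, hg, hfg⟩ := hf'.exists_eq_mul_of_eq_zero_aux ℓ he <| by
    filter_upwards [t.eventually h0] with v hv hℓ
    exact hv (by rw [map_add, hv₀, hℓ, add_zero])
  refine ⟨fun v => g (v - v₀), AnalyticAt.fun_comp (by simpa using hg)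
    (analyticAt_id.sub analyticAt_const), ?_⟩
  filter_upwards [t'.eventually hfg] with v hv
  simpa [hv₀] using hv

end Division

/-! ### Coordinates adapted to a submersion, and division along zero loci -/

section Coordinates

open Topology

/-- A map with surjective derivative is the first component of a local analytic coordinate
system. -/
theorem ContDiffAt.exists_openPartialHomeomorph_fst {E W : Type*}
    [NormedAddCommGroup E] [NormedSpace ℂ E] [FiniteDimensional ℂ E]
    [NormedAddCommGroup W] [NormedSpace ℂ W] [FiniteDimensional ℂ W] {f : E → W} {a : E}
    (hf : ContDiffAt ℂ ω f a) (hs : Function.Surjective (fderiv ℂ f a)) :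
    ∃ (K : Submodule ℂ E) (Φ : OpenPartialHomeomorph E (W × K)), a ∈ Φ.source ∧
      (∀ x, (Φ x).1 = f x) ∧ ContDiffAt ℂ ω Φ a ∧ ContDiffAt ℂ ω Φ.symm (Φ a) := by
  have : CompleteSpace E := FiniteDimensional.complete ℂ E
  have : CompleteSpace W := FiniteDimensional.complete ℂ W
  obtain ⟨P, hP⟩ := (fderiv ℂ f a).ker_closedComplemented_of_finiteDimensional_range
  -- The chart is `x ↦ (f x, P x)`, where `P` is a continuous projection onto the kernel of the
  -- derivative of `f` at `a`; this kernel is the `K` of the statement.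
  let φ : ImplicitFunctionData ℂ E W (fderiv ℂ f a).ker :=
    { leftFun := f
      leftDeriv := fderiv ℂ f a
      rightFun := P
      rightDeriv := P
      pt := a
      hasStrictFDerivAt_leftFun := hf.hasStrictFDerivAt (by simp)
      hasStrictFDerivAt_rightFun := P.hasStrictFDerivAt
      range_leftDeriv := LinearMap.range_eq_top.2 hs
      range_rightDeriv := LinearMap.range_eq_of_proj hP
      isCompl_ker := LinearMap.isCompl_of_proj hP }
  have hΦ : ContDiffAt ℂ ω φ.toOpenPartialHomeomorph a := by
    rw [φ.toOpenPartialHomeomorph_coe]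
    exact hf.prodMk P.contDiff.contDiffAt
  have ha : a ∈ φ.toOpenPartialHomeomorph.source := φ.pt_mem_toOpenPartialHomeomorph_source
  refine ⟨_, φ.toOpenPartialHomeomorph, ha, fun x => rfl, hΦ, ?_⟩
  obtain ⟨M, hM⟩ := φ.isInvertible_fderiv_prodFun
  have e := φ.toOpenPartialHomeomorph.left_inv ha
  refine OpenPartialHomeomorph.contDiffAt_symm (f₀' := M) _
    (φ.toOpenPartialHomeomorph.map_source ha) ?_ ?_
  · rw [e, hM, φ.toOpenPartialHomeomorph_coe]
    exact φ.hasStrictFDerivAt.hasFDerivAt.differentiableAt.hasFDerivAt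
  · rwa [e]

/-- The common zero set of the functions `t i` with `i ∈ B`. -/
def zeroLocus {X : Type*} {r : ℕ} (t : X → Fin r → ℂ) (B : Finset (Fin r)) : Set X := {x | ∀ i ∈ B, t x i = 0}

theorem mem_zeroLocus_insert {X : Type*} {r : ℕ} {t : X → Fin r → ℂ} {B : Finset (Fin r)} {i : Fin r} {x : X} :
    x ∈ zeroLocus t (insert i B) ↔ t x i = 0 ∧ x ∈ zeroLocus t B := by
  simp [zeroLocus]

variable {E : Type*} [NormedAddCommGroup E] [NormedSpace ℂ E]
  {X : Type*} [TopologicalSpace X] [ChartedSpace E X] {r : ℕ} {t : X → Fin r → ℂ}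

theorem IsHolSubmersion.contMDiff_apply
    (ht : IsHolSubmersion (E := E) (E' := Fin r → ℂ) t) (i : Fin r) :
    ContMDiff 𝓘(ℂ, E) 𝓘(ℂ, ℂ) ω fun x => t x i :=
  (ContinuousLinearMap.proj (R := ℂ) (φ := fun _ : Fin r => ℂ) i).contMDiff.comp ht.1

theorem IsHolSubmersion.isClosed_zeroLocus
    (ht : IsHolSubmersion (E := E) (E' := Fin r → ℂ) t) (B : Finset (Fin r)) :
    IsClosed (zeroLocus t B) := by
  simp only [zeroLocus, Set.ofPred_forall]
  exact isClosed_biInter fun i _ =>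
    isClosed_eq (ht.contMDiff_apply i).continuous continuous_const

variable [FiniteDimensional ℂ E]

/-- A manifold chart followed by the coordinates of the implicit function theorem turns `t` into the
first projection. `Φ` and `Ψ` are total functions of which only the germs at `p` and `Φ p` matter.
-/
theorem IsHolSubmersion.exists_coordinates
    (ht : IsHolSubmersion (E := E) (E' := Fin r → ℂ) t) (p : X) :
    ∃ (K : Submodule ℂ E) (Φ : X → (Fin r → ℂ) × K) (Ψ : (Fin r → ℂ) × K → X),
      ContMDiffAt 𝓘(ℂ, E) 𝓘(ℂ, (Fin r → ℂ) × K) ω Φ p ∧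
      ContMDiffAt 𝓘(ℂ, (Fin r → ℂ) × K) 𝓘(ℂ, E) ω Ψ (Φ p) ∧
      (∀ᶠ x in 𝓝 p, Ψ (Φ x) = x) ∧ (∀ᶠ x in 𝓝 p, (Φ x).1 = t x) ∧
      ∀ᶠ v in 𝓝 (Φ p), t (Ψ v) = v.1 := by
  let φ := extChartAt 𝓘(ℂ, E) p
  have hφ : ContMDiffAt 𝓘(ℂ, E) 𝓘(ℂ, E) ω φ p := contMDiffAt_extChartAt
  have hφs : ContMDiffAt 𝓘(ℂ, E) 𝓘(ℂ, E) ω φ.symm (φ p) := by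
    have := contMDiffWithinAt_extChartAt_symm_range_self (I := 𝓘(ℂ, E)) (n := ω) p
    rwa [ModelWithCorners.range_eq_univ, contMDiffWithinAt_univ] at this
  have hf : ContDiffAt ℂ ω (t ∘ φ.symm) (φ p) :=
    contMDiffAt_iff_contDiffAt.1 ((ht.1 _).comp _ hφs)
  have hs : Function.Surjective (fderiv ℂ (t ∘ φ.symm) (φ p)) := by
    have h1 := ht.2 p
    rw [((ht.1 p).mdifferentiableAt (by simp)).mfderiv] at h1
    simpa [writtenInExtChartAt, fderivWithin_univ] using! h1
  obtain ⟨K, H, hHs, hH1, hHc, hHsc⟩ := hf.exists_openPartialHomeomorph_fst hs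
  have n1 : ∀ᶠ x in 𝓝 p, φ.symm (φ x) = x := by
    filter_upwards [extChartAt_source_mem_nhds (I := 𝓘(ℂ, E)) p] with x hx using φ.left_inv hx
  have n2 : ∀ᶠ x in 𝓝 p, H.symm (H (φ x)) = φ x :=
    hφ.continuousAt.eventually (H.eventually_left_inverse hHs)
  refine ⟨K, fun x => H (φ x), fun v => φ.symm (H.symm v),
    (contMDiffAt_iff_contDiffAt.2 hHc).comp p hφ, ?_, ?_, ?_, ?_⟩
  · refine ContMDiffAt.comp (g := φ.symm) (f := H.symm) _ ?_ (contMDiffAt_iff_contDiffAt.2 hHsc)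
    rwa [H.left_inv hHs]
  · filter_upwards [n1, n2] with x h1 h2
    rw [h2, h1]
  · filter_upwards [n1] with x h1
    rw [hH1, Function.comp, h1]
  · filter_upwards [H.eventually_right_inverse (H.map_source hHs)] with v hv
    exact (hH1 (H.symm v)).symm.trans (congrArg Prod.fst hv)

/-- `t i` is not a zero divisor on the zero locus of the `t j` with `j ∈ B`, if `i ∉ B`. -/
theorem IsHolSubmersion.eq_zero_of_mul_eq_zero
    (ht : IsHolSubmersion (E := E) (E' := Fin r → ℂ) t) {B : Finset (Fin r)} {i : Fin r}
    (hi : i ∉ B) {p : X} (hp : p ∈ zeroLocus t B) {h : X → ℂ} (hh : ContinuousAt h p)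
    (h0 : ∀ᶠ x in 𝓝 p, x ∈ zeroLocus t B → t x i * h x = 0) : h p = 0 := by
  by_cases hpi : t p i = 0
  swap
  · simpa [hpi] using h0.self_of_nhds hp
  obtain ⟨K, Φ, Ψ, hΦ, hΨ, hΨΦ, hΦt, htΨ⟩ := ht.exists_coordinates p
  -- The coordinate line through `p` in the direction of `t i`. It stays in the zero locus since `i
  -- ∉ B`, and `t i` equals `w` on it, so `h` vanishes there for `w ≠ 0` near `0`; continuity gives
  -- `h p = 0`.
  let c : ℂ → (Fin r → ℂ) × K := fun w => Φ p + w • (Pi.single i 1, 0)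
  have hc : Continuous c := by fun_prop
  have hc0 : c 0 = Φ p := by simp [c]
  have tc : Filter.Tendsto c (𝓝 0) (𝓝 (Φ p)) := hc0 ▸ hc.tendsto 0
  have tΨ : Filter.Tendsto (fun w => Ψ (c w)) (𝓝 0) (𝓝 p) := by
    have := hΨ.continuousAt.tendsto.comp tc
    rwa [hΨΦ.self_of_nhds] at this
  have ev : ∀ᶠ w in 𝓝[≠] (0 : ℂ), h (Ψ (c w)) = 0 := by
    filter_upwards [nhdsWithin_le_nhds (tΨ.eventually h0), nhdsWithin_le_nhds (tc.eventually htΨ),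
      self_mem_nhdsWithin] with w h1 h2 hw
    have ht' : ∀ j, t (Ψ (c w)) j = t p j + w * (Pi.single i 1 : Fin r → ℂ) j := fun j => by
      rw [h2]
      simp [c, hΦt.self_of_nhds]
    have hz : Ψ (c w) ∈ zeroLocus t B := fun j hj => by
      rw [ht', hp j hj, Pi.single_eq_of_ne (ne_of_mem_of_not_mem hj hi)]
      simp
    have := h1 hz
    rw [ht', hpi] at this
    simpa [show w ≠ 0 from hw] using this
  exact tendsto_nhds_unique ((hh.tendsto.comp tΨ).mono_left nhdsWithin_le_nhds)
    ((Filter.tendsto_congr' ev).2 tendsto_const_nhds)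

/-- A holomorphic function vanishing on the zero locus of `t i` and the `t j` with `j ∈ B` is
locally, on the zero locus of the `t j`, a multiple of `t i`. -/
theorem IsHolSubmersion.exists_eq_mul
    (ht : IsHolSubmersion (E := E) (E' := Fin r → ℂ) t) {B : Finset (Fin r)} {i : Fin r}
    (hi : i ∉ B) (p : X) {h : X → ℂ} (hh : ContMDiffAt 𝓘(ℂ, E) 𝓘(ℂ, ℂ) ω h p)
    (h0 : ∀ᶠ x in 𝓝 p, x ∈ zeroLocus t (insert i B) → h x = 0) :
    ∃ g : X → ℂ, ContMDiffAt 𝓘(ℂ, E) 𝓘(ℂ, ℂ) ω g p ∧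
      ∀ᶠ x in 𝓝 p, x ∈ zeroLocus t B → h x = t x i * g x := by
  by_cases hp : p ∈ zeroLocus t B
  swap
  -- The zero locus is closed, so near `p` there is nothing to check.
  · refine ⟨0, contMDiffAt_const, ?_⟩
    filter_upwards [(ht.isClosed_zeroLocus B).isOpen_compl.mem_nhds hp] with x hx hx'
    exact absurd hx' hx
  by_cases hpi : t p i = 0
  swap
  · have hti := ht.contMDiff_apply i p
    refine ⟨fun x => h x / t x i, hh.div₀ hti hpi, ?_⟩
    filter_upwards [hti.continuousAt.eventually_ne hpi] with x hx _
    field_simp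
  obtain ⟨K, Φ, Ψ, hΦ, hΨ, hΨΦ, hΦt, htΨ⟩ := ht.exists_coordinates p
  -- `Q` sets the coordinates in `B` to zero. Then `h ∘ Ψ ∘ Q` agrees with `h` on the zero locus of
  -- `B`, and it vanishes on the whole hyperplane `ℓ = 0`, which permits division by `ℓ`.
  let D : (Fin r → ℂ) →L[ℂ] (Fin r → ℂ) := ContinuousLinearMap.pi fun j =>
    if j ∈ B then 0 else ContinuousLinearMap.proj j
  have hD : ∀ v j, D v j = if j ∈ B then 0 else v j := fun v j => by
    simp only [D, ContinuousLinearMap.pi_apply]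
    split_ifs <;> simp
  let Q : (Fin r → ℂ) × K →L[ℂ] (Fin r → ℂ) × K := D.prodMap (ContinuousLinearMap.id ℂ K)
  have hQ : ∀ x, x ∈ zeroLocus t B → (Φ x).1 = t x → Q (Φ x) = Φ x := fun x hx hxt => by
    refine Prod.ext (funext fun j => ?_) rfl
    change D (Φ x).1 j = (Φ x).1 j
    rw [hD, hxt]
    split_ifs with hj
    · exact (hx j hj).symm
    · rfl
  have hQp := hQ p hp hΦt.self_of_nhds
  have tQ : Filter.Tendsto Q (𝓝 (Φ p)) (𝓝 (Φ p)) := by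
    simpa only [hQp] using Q.continuous.tendsto (Φ p)
  have tΨ : Filter.Tendsto Ψ (𝓝 (Φ p)) (𝓝 p) := by
    simpa only [hΨΦ.self_of_nhds] using hΨ.continuousAt.tendsto
  let ℓ : (Fin r → ℂ) × K →L[ℂ] ℂ :=
    (ContinuousLinearMap.proj i).comp (ContinuousLinearMap.fst ℂ _ _)
  have hf : AnalyticAt ℂ (fun v => h (Ψ (Q v))) (Φ p) := by
    have h1 : ContMDiffAt 𝓘(ℂ, (Fin r → ℂ) × K) 𝓘(ℂ, E) ω (fun v => Ψ (Q v)) (Φ p) :=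
      ContMDiffAt.comp (g := Ψ) (f := Q) _ (by rwa [hQp]) Q.contMDiff.contMDiffAt
    have h2 : ContMDiffAt 𝓘(ℂ, (Fin r → ℂ) × K) 𝓘(ℂ, ℂ) ω (fun v => h (Ψ (Q v))) (Φ p) :=
      ContMDiffAt.comp (g := h) _ (by rwa [hQp, hΨΦ.self_of_nhds]) h1
    exact (contMDiffAt_iff_contDiffAt.1 h2).analyticAt
  obtain ⟨g, hg, hfg⟩ := hf.exists_eq_mul_of_eq_zero ℓ (e := (Pi.single i 1, 0)) (by simp [ℓ])
    (by simp [ℓ, hΦt.self_of_nhds, hpi]) <| by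
      filter_upwards [tQ.eventually htΨ, (tΨ.comp tQ).eventually h0] with v h1 h2 hℓ
      refine h2 fun j hj => ?_
      change t (Ψ (Q v)) j = 0
      rw [h1]
      change D v.1 j = 0
      rw [hD]
      split_ifs with hjB
      · rfl
      · obtain rfl : j = i := by simpa [hjB] using hj
        exact hℓ
  refine ⟨fun x => g (Φ x), ContMDiffAt.comp (g := g) p
    (contMDiffAt_iff_contDiffAt.2 hg.contDiffAt) hΦ, ?_⟩
  filter_upwards [hΦ.continuousAt.eventually hfg, hΨΦ, hΦt] with x h1 h2 h3 hx
  rw [hQ x hx h3, h2] at h1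
  rw [h1, ← h3]
  rfl

end Coordinates

/-! ### Cutting off and multiplying set-theoretic sections -/

section Cut

variable {X : Type*} {L : X → Type*} [∀ x, AddCommGroup (L x)] [∀ x, Module ℂ (L x)]

open Classical in
/-- The section equal to `s` on `S` and to zero elsewhere. -/
noncomputable def cutSection (S : Set X) : (∀ x, L x) →ₗ[ℂ] ∀ x, L x where
  toFun s x := if x ∈ S then s x else 0
  map_add' s s' := by
    funext x
    by_cases hx : x ∈ S <;> simp [hx]
  map_smul' c s := by
    funext x
    by_cases hx : x ∈ S <;> simp [hx]

theorem cutSection_of_mem {S : Set X} {x : X} (hx : x ∈ S) (s : ∀ x, L x) :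
    cutSection S s x = s x := if_pos hx

theorem cutSection_of_notMem {S : Set X} {x : X} (hx : x ∉ S) (s : ∀ x, L x) :
    cutSection S s x = 0 := if_neg hx

theorem cutSection_cutSection (S T : Set X) (s : ∀ x, L x) :
    cutSection S (cutSection T s) = cutSection (S ∩ T) s := by
  funext x
  by_cases hS : x ∈ S <;> by_cases hT : x ∈ T <;> simp [cutSection, hS, hT]

/-- Multiplication of sections by the function `a`. -/
def smulSection (a : X → ℂ) : (∀ x, L x) →ₗ[ℂ] ∀ x, L x :=
  LinearMap.pi fun x => a x • LinearMap.proj x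

theorem smulSection_apply (a : X → ℂ) (s : ∀ x, L x) (x : X) : smulSection a s x = a x • s x := rfl

theorem smulSection_cutSection (a : X → ℂ) (S : Set X) (s : ∀ x, L x) :
    smulSection a (cutSection S s) = cutSection S (smulSection a s) := by
  funext x
  by_cases hS : x ∈ S <;> simp [smulSection_apply, cutSection, hS]

end Cut

/-! ### Germs of holomorphic sections, and the sheaf along a closed set -/

section Sections

open Topology

universe u v

variable {E : Type*} [NormedAddCommGroup E] [NormedSpace ℂ E]
  {X : Type u} [TopologicalSpace X] [ChartedSpace E X]
  {L : X → Type v} [TopologicalSpace (TotalSpace ℂ L)]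
  [∀ x, TopologicalSpace (L x)] [FiberBundle ℂ L]

variable (E) in
/-- The section `h` of `L` is holomorphic at the point `p`. -/
def HolAt (h : ∀ x, L x) (p : X) : Prop :=
  ContMDiffAt 𝓘(ℂ, E) (𝓘(ℂ, E).prod 𝓘(ℂ, ℂ)) ω (fun x => TotalSpace.mk' ℂ x (h x)) p

theorem holAt_iff {h : ∀ x, L x} {p : X} :
    HolAt E h p ↔ ContMDiffAt 𝓘(ℂ, E) 𝓘(ℂ, ℂ) ω
      (fun x => (trivializationAt ℂ L p ⟨x, h x⟩).2) p :=
  contMDiffAt_section p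

theorem HolAt.congr {h h' : ∀ x, L x} {p : X} (hh : HolAt E h p) (e : ∀ᶠ x in 𝓝 p, h' x = h x) :
    HolAt E h' p :=
  ContMDiffAt.congr_of_eventuallyEq hh <| by
    filter_upwards [e] with x hx
    rw [hx]

theorem eventually_mem_baseSet (p : X) :
    ∀ᶠ x in 𝓝 p, x ∈ (trivializationAt ℂ L p).baseSet :=
  (trivializationAt ℂ L p).open_baseSet.mem_nhds (mem_baseSet_trivializationAt ℂ L p)

/-- Holomorphy at a point of the open set `U` does not depend on values off `U`, so any total
extension of `s` can be used. -/
theorem isHolSection_iff_holAt {U : Opens X} {s : ∀ x : U, L x} {h : ∀ x, L x}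
    (e : ∀ x : U, h x = s x) : IsHolSection E L U s ↔ ∀ x ∈ U, HolAt E h x := by
  obtain rfl : s = fun x : U => h x := funext fun x => (e x).symm
  exact ⟨fun H x hx => (contMDiffAt_subtype_iff (f := fun x => TotalSpace.mk' ℂ x (h x))).1 (H ⟨x, hx⟩),
    fun H x => (contMDiffAt_subtype_iff (f := fun x => TotalSpace.mk' ℂ x (h x))).2 (H x x.2)⟩

variable [∀ x, AddCommGroup (L x)] [∀ x, Module ℂ (L x)] [VectorBundle ℂ ℂ L]

theorem holAt_zero (p : X) : HolAt E (0 : ∀ x, L x) p :=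
  contMDiffAt_zeroSection ℂ L

theorem HolAt.add {h h' : ∀ x, L x} {p : X} (H : HolAt E h p) (H' : HolAt E h' p) :
    HolAt E (h + h') p := by
  rw [holAt_iff] at *
  refine (H.add H').congr_of_eventuallyEq ?_
  filter_upwards [eventually_mem_baseSet (L := L) p] with x hx
  exact ((trivializationAt ℂ L p).linear ℂ hx).map_add _ _

theorem HolAt.smul {a : X → ℂ} {h : ∀ x, L x} {p : X} (ha : ContMDiffAt 𝓘(ℂ, E) 𝓘(ℂ, ℂ) ω a p)
    (H : HolAt E h p) : HolAt E (fun x => a x • h x) p := by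
  rw [holAt_iff] at *
  refine (ContMDiffAt.smul ha H).congr_of_eventuallyEq ?_
  filter_upwards [eventually_mem_baseSet (L := L) p] with x hx
  exact ((trivializationAt ℂ L p).linear ℂ hx).map_smul _ _

theorem HolAt.eventually [IsManifold 𝓘(ℂ, E) ω X] [ContMDiffVectorBundle ω ℂ L 𝓘(ℂ, E)]
    {h : ∀ x, L x} {p : X} (H : HolAt E h p) : ∀ᶠ x in 𝓝 p, HolAt E h x :=
  (contMDiffAt_iff_contMDiffAt_nhds (by simp)).1 H

variable {r : ℕ} {t : X → Fin r → ℂ}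

theorem IsHolSubmersion.eq_zero_of_smul_eq_zero [FiniteDimensional ℂ E]
    (ht : IsHolSubmersion (E := E) (E' := Fin r → ℂ) t) {B : Finset (Fin r)} {i : Fin r}
    (hi : i ∉ B) {p : X} (hp : p ∈ zeroLocus t B) {h : ∀ x, L x} (hh : HolAt E h p)
    (h0 : ∀ᶠ x in 𝓝 p, x ∈ zeroLocus t B → t x i • h x = 0) : h p = 0 := by
  have hp' := mem_baseSet_trivializationAt ℂ L p
  have : (trivializationAt ℂ L p ⟨p, h p⟩).2 = 0 := by
    refine ht.eq_zero_of_mul_eq_zero hi hp (holAt_iff.1 hh).continuousAt ?_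
    filter_upwards [h0, eventually_mem_baseSet (L := L) p] with x hx hxe hxB
    have h1 := ((trivializationAt ℂ L p).linear ℂ hxe).map_smul (t x i) (h x)
    rw [hx hxB, ((trivializationAt ℂ L p).linear ℂ hxe).map_zero] at h1
    exact h1.symm
  exact ((trivializationAt ℂ L p).linearEquivAt ℂ p hp').map_eq_zero_iff.1 this

theorem IsHolSubmersion.exists_eq_smul [FiniteDimensional ℂ E]
    (ht : IsHolSubmersion (E := E) (E' := Fin r → ℂ) t) {B : Finset (Fin r)} {i : Fin r}
    (hi : i ∉ B) (p : X) {h : ∀ x, L x} (hh : HolAt E h p)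
    (h0 : ∀ᶠ x in 𝓝 p, x ∈ zeroLocus t (insert i B) → h x = 0) :
    ∃ g : ∀ x, L x, HolAt E g p ∧ ∀ᶠ x in 𝓝 p, x ∈ zeroLocus t B → h x = t x i • g x := by
  let e := trivializationAt ℂ L p
  obtain ⟨g, hg, hhg⟩ := ht.exists_eq_mul hi p (holAt_iff.1 hh) <| by
    filter_upwards [h0, eventually_mem_baseSet (L := L) p] with x hx hxe hxB
    rw [hx hxB]
    exact ((trivializationAt ℂ L p).linear ℂ hxe).map_zero
  refine ⟨fun x => e.symm x (g x), ?_, ?_⟩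
  · rw [holAt_iff]
    refine hg.congr_of_eventuallyEq ?_
    filter_upwards [eventually_mem_baseSet (L := L) p] with x hx
    exact congrArg Prod.snd (e.apply_mk_symm hx (g x))
  · filter_upwards [hhg, eventually_mem_baseSet (L := L) p] with x hx hxe hxB
    apply (e.linearEquivAt ℂ x hxe).injective
    rw [map_smul, ← e.linearEquivAt_symm_apply (R := ℂ) x hxe, LinearEquiv.apply_symm_apply]
    exact hx hxB

variable (E L) in
/-- The sections over `V ∩ Z` that are locally restrictions of holomorphic sections of `L`,
extended by zero. -/
def locusSections (Z : Set X) (V : Opens X) : Submodule ℂ (∀ x, L x) where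
  carrier := {s | (∀ x, ¬(x ∈ V ∧ x ∈ Z) → s x = 0) ∧
    ∀ x ∈ V, ∃ h : ∀ x, L x, HolAt E h x ∧ ∀ᶠ y in 𝓝 x, y ∈ Z → s y = h y}
  zero_mem' := ⟨fun _ _ => rfl, fun x _ => ⟨0, holAt_zero x, Filter.Eventually.of_forall
    fun _ _ => rfl⟩⟩
  add_mem' := by
    rintro s s' ⟨h1, h2⟩ ⟨h1', h2'⟩
    refine ⟨fun x hx => ?_, fun x hx => ?_⟩
    · rw [Pi.add_apply, h1 x hx, h1' x hx, add_zero]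
    · obtain ⟨h, H, e⟩ := h2 x hx
      obtain ⟨h', H', e'⟩ := h2' x hx
      refine ⟨h + h', H.add H', ?_⟩
      filter_upwards [e, e'] with y hy hy' hz
      rw [Pi.add_apply, Pi.add_apply, hy hz, hy' hz]
  smul_mem' := by
    rintro c s ⟨h1, h2⟩
    refine ⟨fun x hx => ?_, fun x hx => ?_⟩
    · rw [Pi.smul_apply, h1 x hx, smul_zero]
    · obtain ⟨h, H, e⟩ := h2 x hx
      refine ⟨c • h, H.smul contMDiffAt_const, ?_⟩
      filter_upwards [e] with y hy hz
      rw [Pi.smul_apply, Pi.smul_apply, hy hz]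

theorem cutSection_mem_locusSections {Z : Set X} {V W : Opens X} (hVW : V ≤ W) {s : ∀ x, L x}
    (hs : s ∈ locusSections E L Z W) : cutSection (V : Set X) s ∈ locusSections E L Z V := by
  refine ⟨fun x hx => ?_, fun x hx => ?_⟩
  · by_cases hxV : x ∈ V
    · rw [cutSection_of_mem hxV]
      exact hs.1 x fun h => hx ⟨hxV, h.2⟩
    · exact cutSection_of_notMem hxV s
  · obtain ⟨h, H, e⟩ := hs.2 x (hVW hx)
    refine ⟨h, H, ?_⟩
    filter_upwards [e, V.isOpen.mem_nhds hx] with y hy hyV hz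
    rw [cutSection_of_mem hyV, hy hz]

variable (E L) in
/-- The sheaf of holomorphic sections of `L` along the closed set `Z`. -/
noncomputable def locusSheaf (Z : Set X) : (Opens X)ᵒᵖ ⥤ ModuleCat.{max u v} ℂ where
  obj V := ModuleCat.of ℂ (locusSections E L Z V.unop)
  map {W V} f := ModuleCat.ofHom ((cutSection (V.unop : Set X)).restrict
    fun _ hs => cutSection_mem_locusSections f.unop.le hs)
  map_id V := by
    ext s x
    change cutSection (V.unop : Set X) s.1 x = s.1 x
    by_cases hx : x ∈ V.unop
    · exact cutSection_of_mem hx _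
    · rw [cutSection_of_notMem hx, s.2.1 x fun h => hx h.1]
  map_comp {W V V'} f g := by
    ext s x
    change cutSection (V'.unop : Set X) s.1 x
      = cutSection (V'.unop : Set X) (cutSection (V.unop : Set X) s.1) x
    rw [cutSection_cutSection, Set.inter_eq_left.2 g.unop.le]

/-- The section of `L` underlying a section of `locusSheaf`. -/
noncomputable def locusVal (Z : Set X) (V : Opens X) :
    (locusSheaf E L Z).obj (op V) →ₗ[ℂ] ∀ x, L x :=
  (locusSections E L Z V).subtype

section Locus

variable {Z Z' : Set X} {V W : Opens X}

theorem locusVal_injective : Function.Injective (locusVal (E := E) (L := L) Z V) :=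
  Subtype.val_injective

theorem locusVal_mem (s : (locusSheaf E L Z).obj (op V)) : locusVal Z V s ∈ locusSections E L Z V :=
  s.2

theorem exists_locusVal_eq {s : ∀ x, L x} (hs : s ∈ locusSections E L Z V) :
    ∃ y : (locusSheaf E L Z).obj (op V), locusVal Z V y = s := ⟨⟨s, hs⟩, rfl⟩

theorem locusVal_res (h : V ≤ W) (s : (locusSheaf E L Z).obj (op W)) :
    locusVal Z V (Cech.res (locusSheaf E L Z) h s) = cutSection (V : Set X) (locusVal Z W s) := rfl

theorem locusSheaf_bot (s : (locusSheaf E L Z).obj (op ⊥)) : s = 0 := by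
  apply locusVal_injective
  funext x
  rw [map_zero]
  exact (locusVal_mem s).1 x fun h => h.1

/-- The morphism induced by an operator on sections. -/
noncomputable def locusHom (φ : (∀ x, L x) →ₗ[ℂ] ∀ x, L x)
    (hmem : ∀ V, ∀ s ∈ locusSections E L Z V, φ s ∈ locusSections E L Z' V)
    (hcut : ∀ S s, φ (cutSection S s) = cutSection S (φ s)) :
    locusSheaf E L Z ⟶ locusSheaf E L Z' where
  app V := ModuleCat.ofHom (φ.restrict (hmem V.unop))
  naturality {W V} f := by
    ext s
    exact Subtype.ext (hcut (V.unop : Set X) s.1)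

theorem locusVal_locusHom (φ : (∀ x, L x) →ₗ[ℂ] ∀ x, L x)
    (hmem : ∀ V, ∀ s ∈ locusSections E L Z V, φ s ∈ locusSections E L Z' V)
    (hcut : ∀ S s, φ (cutSection S s) = cutSection S (φ s)) (s : (locusSheaf E L Z).obj (op V)) :
    locusVal Z' V (((locusHom φ hmem hcut).app (op V)).hom s) = φ (locusVal Z V s) := rfl

theorem smulSection_mem_locusSections {a : X → ℂ} (ha : ContMDiff 𝓘(ℂ, E) 𝓘(ℂ, ℂ) ω a)
    {s : ∀ x, L x} (hs : s ∈ locusSections E L Z V) :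
    smulSection a s ∈ locusSections E L Z V := by
  refine ⟨fun x hx => ?_, fun x hx => ?_⟩
  · rw [smulSection_apply, hs.1 x hx, smul_zero]
  · obtain ⟨h, H, e⟩ := hs.2 x hx
    refine ⟨fun y => a y • h y, H.smul (ha x), ?_⟩
    filter_upwards [e] with y hy hz
    rw [smulSection_apply, hy hz]

theorem cutSection_mem_locusSections_of_subset (hZ : Z' ⊆ Z) {s : ∀ x, L x}
    (hs : s ∈ locusSections E L Z V) : cutSection Z' s ∈ locusSections E L Z' V := by
  refine ⟨fun x hx => ?_, fun x hx => ?_⟩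
  · by_cases hxZ : x ∈ Z'
    · rw [cutSection_of_mem hxZ]
      exact hs.1 x fun h => hx ⟨h.1, hxZ⟩
    · exact cutSection_of_notMem hxZ s
  · obtain ⟨h, H, e⟩ := hs.2 x hx
    refine ⟨h, H, ?_⟩
    filter_upwards [e] with y hy hz
    rw [cutSection_of_mem hz, hy (hZ hz)]

variable (L) in
/-- Multiplication by the holomorphic function `a`. -/
noncomputable def locusSmul (Z : Set X) {a : X → ℂ} (ha : ContMDiff 𝓘(ℂ, E) 𝓘(ℂ, ℂ) ω a) :
    locusSheaf E L Z ⟶ locusSheaf E L Z :=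
  locusHom (smulSection a) (fun _ _ hs => smulSection_mem_locusSections ha hs)
    (smulSection_cutSection a)

variable (E L) in
/-- Restriction to a smaller closed set. -/
noncomputable def locusRestrict (hZ : Z' ⊆ Z) : locusSheaf E L Z ⟶ locusSheaf E L Z' :=
  locusHom (cutSection Z') (fun _ _ hs => cutSection_mem_locusSections_of_subset hZ hs)
    fun S s => by rw [cutSection_cutSection, cutSection_cutSection, Set.inter_comm]

theorem locusSheaf_sep {U : Opens X} (𝔘 : Cech.OpenCover U)
    (s s' : (locusSheaf E L Z).obj (op U))
    (h : ∀ (α : Fin 1 → 𝔘.ι) (h : 𝔘.inter α ≤ U),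
      Cech.res (locusSheaf E L Z) h s = Cech.res (locusSheaf E L Z) h s') : s = s' := by
  apply locusVal_injective
  funext x
  by_cases hx : x ∈ U
  · obtain ⟨i, hi⟩ : ∃ i, x ∈ 𝔘.obj i := by
      rw [← 𝔘.iSup_obj] at hx
      simpa using hx
    have hxi : x ∈ 𝔘.inter (fun _ : Fin 1 => i) := (𝔘.mem_inter _ _).2 fun _ => hi
    have hle : 𝔘.inter (fun _ : Fin 1 => i) ≤ U :=
      (iInf_le _ 0).trans ((le_iSup 𝔘.obj i).trans_eq 𝔘.iSup_obj)
    have := congrFun (congrArg (locusVal _ _) (h _ hle)) x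
    rwa [locusVal_res, locusVal_res, cutSection_of_mem hxi, cutSection_of_mem hxi] at this
  · rw [(locusVal_mem s).1 x fun h => hx h.1, (locusVal_mem s').1 x fun h => hx h.1]

/-- This is the cocycle condition on the pair `(i, j)`, evaluated at `x`. -/
theorem locusVal_eq_of_δ_eq_zero {U : Opens X} (𝔘 : Cech.OpenCover U)
    (b : Cech.Cochain (locusSheaf E L Z) 𝔘 0) (hb : Cech.δ (locusSheaf E L Z) 𝔘 0 b = 0)
    {i j : 𝔘.ι} {x : X} (hi : x ∈ 𝔘.obj i) (hj : x ∈ 𝔘.obj j) :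
    locusVal _ _ (b fun _ => i) x = locusVal _ _ (b fun _ => j) x := by
  have h0 := congrFun (congrArg (locusVal _ _) (congrFun hb ![i, j])) x
  have hx : x ∈ 𝔘.inter ![i, j] := by
    rw [𝔘.mem_inter, Fin.forall_fin_two]
    exact ⟨hi, hj⟩
  rw [Cech.δ_apply, Fin.sum_univ_two, Pi.zero_apply, map_zero, map_add, map_smul, map_smul,
    locusVal_res, locusVal_res, Pi.add_apply, Pi.smul_apply, Pi.smul_apply, cutSection_of_mem hx,
    cutSection_of_mem hx] at h0
  have e0 : ![i, j] ∘ (0 : Fin 2).succAbove = fun _ => j := funext fun l => by fin_cases l; rfl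
  have e1 : ![i, j] ∘ (1 : Fin 2).succAbove = fun _ => i := funext fun l => by fin_cases l; rfl
  rw [e0, e1] at h0
  simp only [Fin.val_zero, pow_zero, one_smul, Fin.val_one, pow_one, neg_smul, Pi.zero_apply,
    ← sub_eq_add_neg, sub_eq_zero] at h0
  exact h0.symm

/-- A `0`-cocycle has a well-defined value at each point of `U`, and being locally the trace of a
holomorphic section is a local condition. -/
theorem locusSheaf_glue {U : Opens X} (𝔘 : Cech.OpenCover U)
    (b : Cech.Cochain (locusSheaf E L Z) 𝔘 0) (hb : Cech.δ (locusSheaf E L Z) 𝔘 0 b = 0) :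
    ∃ y : (locusSheaf E L Z).obj (op U), ∀ (α : Fin 1 → 𝔘.ι) (h : 𝔘.inter α ≤ U),
      Cech.res (locusSheaf E L Z) h y = b α := by
  classical
  let s : ∀ x, L x := fun x =>
    if h : ∃ i, x ∈ 𝔘.obj i then locusVal _ _ (b fun _ => h.choose) x else 0
  have hs : ∀ i x, x ∈ 𝔘.obj i → s x = locusVal _ _ (b fun _ => i) x := fun i x hx => by
    have h : ∃ i, x ∈ 𝔘.obj i := ⟨i, hx⟩
    simp only [s, dif_pos h]
    exact locusVal_eq_of_δ_eq_zero 𝔘 b hb h.choose_spec hx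
  have hU : ∀ x, x ∈ U ↔ ∃ i, x ∈ 𝔘.obj i := fun x => by
    conv_lhs => rw [← 𝔘.iSup_obj]
    simp
  have mem : ∀ i x, x ∈ 𝔘.obj i → x ∈ 𝔘.inter (fun _ : Fin 1 => i) := fun i x hx =>
    (𝔘.mem_inter _ _).2 fun _ => hx
  obtain ⟨y, hy⟩ : ∃ y : (locusSheaf E L Z).obj (op U), locusVal Z U y = s := by
    refine exists_locusVal_eq ⟨fun x hx => ?_, fun x hx => ?_⟩
    · by_cases h : ∃ i, x ∈ 𝔘.obj i
      · obtain ⟨i, hi⟩ := h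
        rw [hs i x hi]
        exact (locusVal_mem _).1 x fun h' => hx ⟨(hU x).2 ⟨i, hi⟩, h'.2⟩
      · exact dif_neg h
    · obtain ⟨i, hi⟩ := (hU x).1 hx
      obtain ⟨h, H, e⟩ := (locusVal_mem (b fun _ => i)).2 x (mem i x hi)
      refine ⟨h, H, ?_⟩
      filter_upwards [e, (𝔘.obj i).isOpen.mem_nhds hi] with z hz hzi hzZ
      rw [hs i z hzi, hz hzZ]
  refine ⟨y, fun α h => locusVal_injective (funext fun x => ?_)⟩
  obtain ⟨i, rfl⟩ : ∃ i, α = fun _ => i := ⟨α 0, funext fun l => by rw [Subsingleton.elim l 0]⟩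
  rw [locusVal_res, hy]
  by_cases hx : x ∈ 𝔘.obj i
  · rw [cutSection_of_mem (mem i x hx), hs i x hx]
  · have hx' : x ∉ 𝔘.inter (fun _ : Fin 1 => i) := fun h' => hx ((𝔘.mem_inter _ _).1 h' 0)
    rw [cutSection_of_notMem hx', (locusVal_mem (b fun _ => i)).1 x fun h' => hx' h'.1]

/-- Near `x` the section is the trace on `Z'` of a holomorphic germ `h`; on a neighbourhood where
`h` is holomorphic, the trace of `h` on the larger set `Z` is a lift. -/
theorem locusRestrict_locally_surjective [IsManifold 𝓘(ℂ, E) ω X]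
    [ContMDiffVectorBundle ω ℂ L 𝓘(ℂ, E)] (hZ : Z' ⊆ Z) (V : Opens X)
    (s : (locusSheaf E L Z').obj (op V)) (x : X) (hx : x ∈ V) :
    ∃ (W : Opens X) (h : W ≤ V), x ∈ W ∧
      ∃ y, ((locusRestrict E L hZ).app (op W)).hom y = Cech.res (locusSheaf E L Z') h s := by
  obtain ⟨h, H, e⟩ := (locusVal_mem s).2 x hx
  obtain ⟨W, hW, Wo, xW⟩ := mem_nhds_iff.1 (Filter.inter_mem (Filter.inter_mem H.eventually e)
    (V.isOpen.mem_nhds hx))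
  refine ⟨⟨W, Wo⟩, fun y hy => (hW hy).2, xW, ?_⟩
  obtain ⟨y, hy⟩ : ∃ y : (locusSheaf E L Z).obj (op ⟨W, Wo⟩),
      locusVal Z ⟨W, Wo⟩ y = cutSection (W ∩ Z) h := by
    refine exists_locusVal_eq ⟨fun z hz => cutSection_of_notMem (S := W ∩ Z) hz h, fun z hz =>
      ⟨h, (hW hz).1.1, ?_⟩⟩
    filter_upwards [Wo.mem_nhds hz] with w hw hwZ
    exact cutSection_of_mem (S := W ∩ Z) ⟨hw, hwZ⟩ h
  refine ⟨y, locusVal_injective (funext fun z => ?_)⟩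
  rw [locusRestrict, locusVal_locusHom, hy, locusVal_res]
  by_cases hzZ : z ∈ Z'
  · rw [cutSection_of_mem hzZ]
    by_cases hzW : z ∈ W
    · rw [cutSection_of_mem (S := W ∩ Z) ⟨hzW, hZ hzZ⟩,
        cutSection_of_mem (S := ((⟨W, Wo⟩ : Opens X) : Set X)) hzW]
      exact ((hW hzW).1.2 hzZ).symm
    · rw [cutSection_of_notMem (S := W ∩ Z) fun h => hzW h.1,
        cutSection_of_notMem (S := ((⟨W, Wo⟩ : Opens X) : Set X)) hzW]
  · rw [cutSection_of_notMem hzZ]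
    by_cases hzW : z ∈ W
    · rw [cutSection_of_mem (S := ((⟨W, Wo⟩ : Opens X) : Set X)) hzW,
        (locusVal_mem s).1 z fun h => hzZ h.2]
    · rw [cutSection_of_notMem (S := ((⟨W, Wo⟩ : Opens X) : Set X)) hzW]

end Locus

end Sections

section Extend

variable {X : Type*} [TopologicalSpace X] {L : X → Type*}
  [∀ x, AddCommGroup (L x)] [∀ x, Module ℂ (L x)]

open Classical in
/-- Extension by zero of a section over `V`. -/
noncomputable def extendSection (V : Opens X) : (∀ x : V, L x) →ₗ[ℂ] ∀ x, L x where
  toFun s x := if h : x ∈ V then s ⟨x, h⟩ else 0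
  map_add' s s' := by
    funext x
    by_cases hx : x ∈ V <;> simp [hx]
  map_smul' c s := by
    funext x
    by_cases hx : x ∈ V <;> simp [hx]

theorem extendSection_of_mem {V : Opens X} {x : X} (hx : x ∈ V) (s : ∀ x : V, L x) :
    extendSection V s x = s ⟨x, hx⟩ := dif_pos hx

theorem extendSection_of_notMem {V : Opens X} {x : X} (hx : x ∉ V) (s : ∀ x : V, L x) :
    extendSection V s x = 0 := dif_neg hx

end Extend

theorem zeroLocus_insert_subset {X : Type*} {r : ℕ} (t : X → Fin r → ℂ) (B : Finset (Fin r))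
    (i : Fin r) : zeroLocus t (insert i B) ⊆ zeroLocus t B :=
  fun _ hx => (mem_zeroLocus_insert.1 hx).2

/-! ### The exact sequence of a coordinate and the two inductions -/

section Hadamard

open Topology

universe u v

variable {E : Type*} [NormedAddCommGroup E] [NormedSpace ℂ E]
  {X : Type u} [TopologicalSpace X] [ChartedSpace E X]
  {L : X → Type v} [TopologicalSpace (TotalSpace ℂ L)]
  [∀ x, AddCommGroup (L x)] [∀ x, Module ℂ (L x)] [∀ x, TopologicalSpace (L x)]
  [FiberBundle ℂ L] [VectorBundle ℂ ℂ L]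

theorem mem_holSections_iff {V : Opens X} {s : ∀ x : V, L x} :
    s ∈ holSections E L V ↔ ∀ x ∈ V, HolAt E (extendSection V s) x :=
  isHolSection_iff_holAt fun x => extendSection_of_mem x.2 s

theorem extendSection_mem_locusSections (Z : Set X) {V : Opens X} {s : ∀ x : V, L x}
    (hs : s ∈ holSections E L V) :
    cutSection Z (extendSection V s) ∈ locusSections E L Z V := by
  refine cutSection_mem_locusSections_of_subset (Z := Set.univ) (Set.subset_univ _)
    ⟨fun x hx => extendSection_of_notMem (fun h => hx ⟨h, trivial⟩) s, fun x hx =>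
      ⟨_, mem_holSections_iff.1 hs x hx, Filter.Eventually.of_forall fun _ _ => rfl⟩⟩

variable (E L) in
/-- Restriction of holomorphic sections of `L` to the closed set `Z`. -/
noncomputable def holToLocus (Z : Set X) : holSheaf E L ⟶ locusSheaf E L Z where
  app V := ModuleCat.ofHom ((cutSection Z ∘ₗ extendSection V.unop).restrict
    fun _ hs => extendSection_mem_locusSections Z hs)
  naturality {W V} f := by
    ext s
    refine locusVal_injective (Z := Z) (V := V.unop) (funext fun x => ?_)
    change cutSection Z (extendSection V.unop fun x => s.1 ⟨x, f.unop.le x.2⟩) x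
      = cutSection (V.unop : Set X) (cutSection Z (extendSection W.unop s.1)) x
    by_cases hZ : x ∈ Z <;> by_cases hV : x ∈ V.unop
    · rw [cutSection_of_mem hZ, extendSection_of_mem hV,
        cutSection_of_mem (S := (V.unop : Set X)) hV, cutSection_of_mem hZ,
        extendSection_of_mem (f.unop.le hV)]
    · rw [cutSection_of_mem hZ, extendSection_of_notMem hV,
        cutSection_of_notMem (S := (V.unop : Set X)) hV]
    · rw [cutSection_of_notMem hZ, cutSection_of_mem (S := (V.unop : Set X)) hV,
        cutSection_of_notMem hZ]
    · rw [cutSection_of_notMem hZ, cutSection_of_notMem (S := (V.unop : Set X)) hV]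

theorem locusVal_holToLocus (Z : Set X) (V : Opens X) (s : holSections E L V) :
    locusVal Z V (((holToLocus E L Z).app (op V)).hom s) = cutSection Z (extendSection V s.1) := rfl

/-- Along all of `X` the locus sheaf is `𝒪_L` itself, which is the base case of the induction. -/
theorem holToLocus_univ_bijective [IsManifold 𝓘(ℂ, E) ω X] [ContMDiffVectorBundle ω ℂ L 𝓘(ℂ, E)]
    (V : Opens X) : Function.Bijective ((holToLocus E L Set.univ).app (op V)).hom := by
  have key : ∀ (s : holSections E L V) (x : V),
      locusVal _ V (((holToLocus E L Set.univ).app (op V)).hom s) x = s.1 x := fun s x => by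
    rw [locusVal_holToLocus, cutSection_of_mem (Set.mem_univ _), extendSection_of_mem x.2]
  constructor
  · intro s s' h
    refine Subtype.ext (funext fun x => ?_)
    rw [← key s x, ← key s' x, h]
  · intro s
    have hs : (fun x : V => locusVal _ V s x) ∈ holSections E L V := by
      refine (isHolSection_iff_holAt fun x => rfl).2 fun x hx => ?_
      obtain ⟨h, H, e⟩ := (locusVal_mem s).2 x hx
      exact H.congr (by filter_upwards [e] with y hy using hy trivial)
    refine ⟨⟨_, hs⟩, locusVal_injective (funext fun x => ?_)⟩
    by_cases hx : x ∈ V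
    · exact key ⟨_, hs⟩ ⟨x, hx⟩
    · rw [locusVal_holToLocus, cutSection_of_mem (Set.mem_univ _), extendSection_of_notMem hx,
        (locusVal_mem s).1 x fun h => hx h.1]

variable [FiniteDimensional ℂ E] {r : ℕ} {t : X → Fin r → ℂ}

theorem locusSmul_injective
    (ht : IsHolSubmersion (E := E) (E' := Fin r → ℂ) t)
    {B : Finset (Fin r)} {i : Fin r} (hi : i ∉ B) (V : Opens X) :
    Function.Injective
      ((locusSmul L (zeroLocus t B) (ht.contMDiff_apply i)).app (op V)).hom := by
  rw [injective_iff_map_eq_zero]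
  intro s hs
  refine locusVal_injective (funext fun x => ?_)
  rw [map_zero]
  by_cases hx : x ∈ V ∧ x ∈ zeroLocus t B
  swap
  · exact (locusVal_mem s).1 x hx
  obtain ⟨h, H, e⟩ := (locusVal_mem s).2 x hx.1
  rw [e.self_of_nhds hx.2]
  refine ht.eq_zero_of_smul_eq_zero hi hx.2 H ?_
  have h0 : smulSection (fun x => t x i) (locusVal _ V s) = 0 :=
    (locusVal_locusHom _ _ _ s).symm.trans ((congrArg (locusVal _ V) hs).trans (map_zero _))
  filter_upwards [e] with y hy hyB
  rw [← hy hyB]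
  exact congrFun h0 y

variable [IsManifold 𝓘(ℂ, E) ω X] [ContMDiffVectorBundle ω ℂ L 𝓘(ℂ, E)]

/-- Local quotients by `t i` exist by division in coordinates. On the zero locus of `B` they are
unique, because `t i` is not a zero divisor there, so they glue to one section. -/
theorem locusRestrict_exact
    (ht : IsHolSubmersion (E := E) (E' := Fin r → ℂ) t)
    {B : Finset (Fin r)} {i : Fin r} (hi : i ∉ B) (V : Opens X)
    (s : (locusSheaf E L (zeroLocus t B)).obj (op V)) :
    ((locusRestrict E L (zeroLocus_insert_subset t B i)).app (op V)).hom s = 0 ↔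
      ∃ y, ((locusSmul L (zeroLocus t B) (ht.contMDiff_apply i)).app (op V)).hom y = s := by
  constructor
  · intro hs
    have h0 : ∀ x ∈ zeroLocus t (insert i B), locusVal _ V s x = 0 := fun x hx => by
      rw [← cutSection_of_mem hx (locusVal _ V s)]
      have := (locusVal_locusHom _ _ _ s).symm.trans ((congrArg (locusVal _ V) hs).trans (map_zero _))
      exact congrFun this x
    have loc : ∀ x ∈ V, ∃ g : ∀ x, L x, HolAt E g x ∧
        ∀ᶠ y in 𝓝 x, y ∈ zeroLocus t B → locusVal _ V s y = t y i • g y := fun x hx => by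
      obtain ⟨h, H, e⟩ := (locusVal_mem s).2 x hx
      obtain ⟨g, hg, hhg⟩ := ht.exists_eq_smul hi x H <| by
        filter_upwards [e] with y hy hyB
        rw [← hy (zeroLocus_insert_subset t B i hyB), h0 y hyB]
      refine ⟨g, hg, ?_⟩
      filter_upwards [e, hhg] with y hy hy' hyB
      rw [hy hyB, hy' hyB]
    have uniq : ∀ x ∈ zeroLocus t B, ∀ g g' : ∀ x, L x, HolAt E g x → HolAt E g' x →
        (∀ᶠ y in 𝓝 x, y ∈ zeroLocus t B → locusVal _ V s y = t y i • g y) →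
        (∀ᶠ y in 𝓝 x, y ∈ zeroLocus t B → locusVal _ V s y = t y i • g' y) → g x = g' x := by
      intro x hx g g' hg hg' e e'
      rw [← sub_eq_zero]
      have H : HolAt E (fun y => g y - g' y) x := by
        have := hg.add (hg'.smul (a := fun _ => -1) contMDiffAt_const)
        exact this.congr (Filter.Eventually.of_forall fun y => by simp [sub_eq_add_neg])
      refine ht.eq_zero_of_smul_eq_zero hi hx H ?_
      filter_upwards [e, e'] with y hy hy' hyB
      rw [smul_sub, ← hy hyB, ← hy' hyB, sub_self]
    choose! g hg hsg using loc
    -- The germ `g x` is still a holomorphic quotient at nearby points `y`, so uniqueness at `y`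
    -- compares it with `g y`. Hence the diagonal `x ↦ g x x` is, along the zero locus, locally the
    -- trace of a holomorphic section.
    have near : ∀ x ∈ V, ∀ᶠ y in 𝓝 x, y ∈ V ∧ (y ∈ zeroLocus t B → g y y = g x y) := by
      intro x hx
      filter_upwards [V.isOpen.mem_nhds hx, (hg x hx).eventually, (hsg x hx).eventually_nhds]
        with y hyV hy hy'
      exact ⟨hyV, fun hyB => uniq y hyB _ _ (hg y hyV) hy (hsg y hyV) hy'⟩
    obtain ⟨y, hy⟩ : ∃ y : (locusSheaf E L (zeroLocus t B)).obj (op V),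
        locusVal _ V y = cutSection (V ∩ zeroLocus t B) fun x => g x x := by
      refine exists_locusVal_eq
        ⟨fun x hx => cutSection_of_notMem (S := V ∩ zeroLocus t B) hx _, fun x hx =>
          ⟨g x, hg x hx, ?_⟩⟩
      filter_upwards [near x hx] with y hy hyB
      rw [cutSection_of_mem (S := V ∩ zeroLocus t B) ⟨hy.1, hyB⟩, hy.2 hyB]
    refine ⟨y, locusVal_injective (funext fun x => ?_)⟩
    rw [locusSmul, locusVal_locusHom, hy, smulSection_apply]
    by_cases hx : x ∈ V ∧ x ∈ zeroLocus t B
    · rw [cutSection_of_mem (S := V ∩ zeroLocus t B) hx, (hsg x hx.1).self_of_nhds hx.2]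
    · rw [cutSection_of_notMem (S := V ∩ zeroLocus t B) hx, (locusVal_mem s).1 x hx, smul_zero]
  · rintro ⟨y, rfl⟩
    refine locusVal_injective (funext fun x => ?_)
    rw [locusRestrict, locusVal_locusHom, locusSmul, locusVal_locusHom, map_zero]
    by_cases hx : x ∈ zeroLocus t (insert i B)
    · rw [cutSection_of_mem hx, smulSection_apply, (mem_zeroLocus_insert.1 hx).1, zero_smul]
      rfl
    · rw [cutSection_of_notMem hx]
      rfl

/-- In the sequence for `i ∉ B` the first two sheaves are both the one for `B`, so its acyclicity
passes to the quotient and lets global sections of the quotient lift to it; from there they lift to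
`𝒪_L` by induction. -/
theorem locusSheaf_acyclic_and_surjective
    (ht : IsHolSubmersion (E := E) (E' := Fin r → ℂ) t)
    {U : Opens X} [ParacompactSpace U] [NormalSpace U]
    (hU : Cech.AcyclicOver (holSheaf E L) U) (B : Finset (Fin r)) :
    Cech.AcyclicOver (locusSheaf E L (zeroLocus t B)) U ∧
      Function.Surjective ((holToLocus E L (zeroLocus t B)).app (op U)).hom := by
  induction B using Finset.induction_on with
  | empty =>
    have h : zeroLocus t ∅ = Set.univ := Set.eq_univ_of_forall fun x i hi => by simp at hi
    rw [h]
    exact ⟨hU.of_bijective _ holToLocus_univ_bijective, (holToLocus_univ_bijective U).2⟩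
  | insert i B hi ih =>
    have inj := locusSmul_injective (L := L) ht hi
    have exact := locusRestrict_exact (L := L) ht hi
    have surj := locusRestrict_locally_surjective (E := E) (L := L) (zeroLocus_insert_subset t B i)
    refine ⟨Cech.AcyclicOver.of_exact _ _ locusSheaf_bot inj exact surj ih.1 ih.1, ?_⟩
    have hsurj := Cech.surjective_of_exact _ _ locusSheaf_bot inj exact surj locusSheaf_glue
      locusSheaf_sep ih.1
    intro s
    obtain ⟨s', rfl⟩ := hsurj s
    obtain ⟨s'', rfl⟩ : ∃ s'' : holSections E L U,
        ((holToLocus E L (zeroLocus t B)).app (op U)).hom s'' = s' := ih.2 s'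
    refine ⟨s'', locusVal_injective ?_⟩
    rw [locusRestrict, locusVal_locusHom, locusVal_holToLocus, locusVal_holToLocus,
      cutSection_cutSection, Set.inter_eq_left.2 (zeroLocus_insert_subset t B i)]

theorem exists_eq_sum_smul
    (ht : IsHolSubmersion (E := E) (E' := Fin r → ℂ) t)
    {U : Opens X} [ParacompactSpace U] [NormalSpace U]
    (hU : Cech.AcyclicOver (holSheaf E L) U) (B : Finset (Fin r)) (s : holSections E L U)
    (hs : ∀ x : U, (x : X) ∈ zeroLocus t B → s.1 x = 0) :
    ∃ σ : Fin r → holSections E L U, ∀ x : U, s.1 x = ∑ i ∈ B, t x i • (σ i).1 x := by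
  induction B using Finset.induction_on generalizing s with
  | empty => exact ⟨0, fun x => by simpa using hs x fun i hi => by simp at hi⟩
  | insert i B hi ih =>
    obtain ⟨y, hy⟩ := (locusRestrict_exact ht hi U
        (((holToLocus E L (zeroLocus t B)).app (op U)).hom s)).1 <| by
      refine locusVal_injective (funext fun x => ?_)
      rw [locusRestrict, locusVal_locusHom, locusVal_holToLocus, cutSection_cutSection,
        Set.inter_eq_left.2 (zeroLocus_insert_subset t B i), map_zero]
      by_cases hx : x ∈ zeroLocus t (insert i B)
      · rw [cutSection_of_mem hx]
        by_cases hxU : x ∈ U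
        · rw [extendSection_of_mem hxU]
          exact hs ⟨x, hxU⟩ hx
        · exact extendSection_of_notMem hxU _
      · exact cutSection_of_notMem hx _
    obtain ⟨τ, rfl⟩ : ∃ τ : holSections E L U,
        ((holToLocus E L (zeroLocus t B)).app (op U)).hom τ = y :=
      (locusSheaf_acyclic_and_surjective ht hU B).2 y
    have hτ : ∀ x : U, (x : X) ∈ zeroLocus t B → s.1 x = t x i • τ.1 x := by
      intro x hx
      have := congrFun (congrArg (locusVal _ U) hy) x
      rw [locusSmul, locusVal_locusHom, smulSection_apply, locusVal_holToLocus,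
        locusVal_holToLocus, cutSection_of_mem hx, cutSection_of_mem hx,
        extendSection_of_mem x.2, extendSection_of_mem x.2] at this
      exact this.symm
    have hmem : (fun x : U => t x i • τ.1 x) ∈ holSections E L U := by
      refine (isHolSection_iff_holAt (h := fun x => t x i • extendSection U τ.1 x)
        fun x => ?_).2 fun x hx =>
          (mem_holSections_iff.1 τ.2 x hx).smul (ht.contMDiff_apply i x)
      rw [extendSection_of_mem x.2]
    obtain ⟨σ, hσ⟩ := ih (s - ⟨_, hmem⟩) fun x hx => sub_eq_zero.2 (hτ x hx)
    -- As `i ∉ B`, inserting `τ` at `i` leaves the sum over `B` unchanged.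
    refine ⟨Function.update σ i τ, fun x => ?_⟩
    rw [Finset.sum_insert hi, Function.update_self, ← sub_eq_iff_eq_add']
    refine (hσ x).trans (Finset.sum_congr rfl fun j hj => ?_)
    rw [Function.update_of_ne (ne_of_mem_of_not_mem hj hi)]

end Hadamard

theorem theoremA1
    {E : Type*} [NormedAddCommGroup E] [NormedSpace ℂ E] [FiniteDimensional ℂ E]
    {X : Type*} [TopologicalSpace X] [T2Space X] [SecondCountableTopology X]
    [ChartedSpace E X] [IsManifold 𝓘(ℂ, E) ω X]
    (L : X → Type*) [TopologicalSpace (TotalSpace ℂ L)]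
    [∀ x, AddCommGroup (L x)] [∀ x, Module ℂ (L x)] [∀ x, TopologicalSpace (L x)]
    [FiberBundle ℂ L] [VectorBundle ℂ ℂ L] [ContMDiffVectorBundle ω ℂ L 𝓘(ℂ, E)]
    (r : ℕ) (t : X → Fin r → ℂ) (ht : IsHolSubmersion (E := E) (E' := Fin r → ℂ) t)
    (A : Finset (Fin r)) (U : Opens X)
    (hU : ∀ d : ℕ, 1 ≤ d → Subsingleton (Cech.H (holSheaf E L) d U))
    (s : holSections E L U)
    (hs : ∀ x : U, (∀ i ∈ A, t x i = 0) → s.1 x = 0) :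
    ∃ σ : A → holSections E L U, ∀ x : U, s.1 x = ∑ i : A, t x i • (σ i).1 x := by
  -- Local compactness, together with the Hausdorff and second countability hypotheses, makes `U`
  -- paracompact and normal, as the refinement argument requires.
  have : ProperSpace E := FiniteDimensional.proper ℂ E
  have : LocallyCompactSpace X := ChartedSpace.locallyCompactSpace E X
  have : LocallyCompactSpace U := U.isOpen.locallyCompactSpace
  obtain ⟨σ, hσ⟩ := exists_eq_sum_smul ht (Cech.acyclicOver_of_subsingleton_H _ hU) A s hs
  refine ⟨fun i => σ i, fun x => ?_⟩
  rw [hσ x, ← Finset.sum_coe_sort]
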